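/- Let $K\subset\mathbb R^n$ be an origin-symmetric star body: a compact set with $K=-K$, star-shaped with respect to the origin, whose radial function $\rho_K(x)=\max\{a>0: ax\in K\}$ is positive and continuous on $S^{n-1}$. Let $\|x\|=\inf\{a>0:x\in aK\}$ be its Minkowski functional, and suppose that $K$ has $C^\infty$ boundary in the sense that $\|\cdot\|$ (equivalently $\rho_K$) is infinitely differentiable on $\mathbb R^n\setminus\{0\}$. For $\xi\in S^{n-1}$ let $$A_\xi(z)=\mathrm{vol}_{n-1}\bigl(K\cap(\xi^\perp+z\xi)\bigr),\qquad z\in\mathbb R,$$ be the parallel section function of $K$. For a function $g:\mathbb R\to\mathbb R$ that is $C^\infty$ on a neighbourhood of $0$, and for $\lambda\in\mathbb C\setminus\{-1,-2,\dots\}$ and an integer $m\ge 0$ with $\operatorname{Re}\lambda>-m-1$, put $$\langle t_+^\lambda,g\rangle=\int_0^1t^\lambda\Bigl(g(t)-\sum_{k=0}^{m-1}\frac{g^{(k)}(0)}{k!}t^k\Bigr)dt+\int_1^\infty t^\lambda g(t)\,dt+\sum_{k=0}^{m-1}\frac{g^{(k)}(0)}{k!\,(\lambda+k+1)}$$ whenever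 the integrals converge absolutely; this does not depend on $m$. Define the fractional derivative of order $q\in\mathbb C$ at zero by $$g^{(q)}(0)=\Bigl\langle\frac{t_+^{-q-1}}{\Gamma(-q)},g\Bigr\rangle=\frac{1}{\Gamma(-q)}\langle t_+^{-q-1},g\rangle\quad(q\ne0,1,2,\dots),$$ and, for $q=k\in\{0,1,2,\dots\}$, by the value $(-1)^k\frac{d^k g}{dt^k}(0)$ of the analytic continuation in $q$. Let $q\in\mathbb C$ with $\operatorname{Re}q>-1$ and $q\ne n-1$. Then $\|x\|^{-n+q+1}$ defines a tempered distribution on $\mathbb R^n$ by integration. Its Fourier transform, taken in the sense of distributions with $\hat\varphi(w)=\int_{\mathbb R^n}\varphi(x)e^{-i\langle x,w\rangle}dx$ and $\langle\hat f,\varphi\rangle=\langle f,\hat\varphi\rangle$, coincides on $\mathbb R^n\setminus\{0\}$ with a continuous function, denoted by $(\|x\|^{-n+q+1})^\wedge(\xi)$. For every $\xi\in S^{n-1}$ the function $A_\xi$ is $C^\infty$ on a neighbourhood of $0$, the integrals defining $A_\xi^{(q)}(0)$ converge absolutely, and $$A_\xi^{(q)}(0)=\frac{\cos\frac{q\pi}{2}}{\pi(n-q-1)}\,\bigl(\|x\|^{-n+q+1}\bigr)^\wedge(\xi).$$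 -/

import Mathlib

open MeasureTheory Set Filter Topology
open scoped SchwartzMap FourierTransform ContDiff

noncomputable section

/-! ### Star bodies -/

/-- The radial function `ρ_K(x) = max {a > 0 : a x ∈ K}`, for `x ≠ 0`. -/
def radialFunction {n : ℕ} (K : Set (EuclideanSpace ℝ (Fin n))) (x : EuclideanSpace ℝ (Fin n)) :
    ℝ :=
  sSup {a : ℝ | 0 < a ∧ a • x ∈ K}

/-- An origin-symmetric star body: a compact set, star-shaped with respect to the origin and
symmetric about it, whose radial function is positive and continuous on the unit sphere.
(By compactness the supremum in the radial function is a maximum.) -/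
structure IsSymmetricStarBody {n : ℕ} (K : Set (EuclideanSpace ℝ (Fin n))) : Prop where
  isCompact : IsCompact K
  starConvex : StarConvex ℝ 0 K
  symmetric : ∀ x ∈ K, -x ∈ K
  radial_pos : ∀ θ ∈ Metric.sphere (0 : EuclideanSpace ℝ (Fin n)) 1, 0 < radialFunction K θ
  radial_continuousOn :
    ContinuousOn (radialFunction K) (Metric.sphere (0 : EuclideanSpace ℝ (Fin n)) 1)

/-- A star body with `C^∞` boundary: its Minkowski functional (equivalently its radial function)
is infinitely differentiable away from the origin. -/
def HasSmoothBoundary {n : ℕ} (K : Set (EuclideanSpace ℝ (Fin n))) : Prop :=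
  ContDiffOn ℝ ∞ (gauge K) {0}ᶜ

/-- The parallel section function `A_ξ(z) = vol_{n-1}(K ∩ (ξ^⊥ + z ξ))` for a unit vector `ξ`.
The hyperplane `ξ^⊥ + z ξ` is identified isometrically with `ξ^⊥` by `y ↦ y + z ξ`, and `volume` on
the Euclidean space `ξ^⊥` is `(n-1)`-dimensional Lebesgue measure. -/
def parallelSection {n : ℕ} (K : Set (EuclideanSpace ℝ (Fin n))) (ξ : EuclideanSpace ℝ (Fin n))
    (z : ℝ) : ℝ :=
  (volume : Measure (ℝ ∙ ξ)ᗮ).real {y | (y : EuclideanSpace ℝ (Fin n)) + z • ξ ∈ K}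

/-! ### Fractional derivatives at zero -/

/-- The Taylor polynomial of `g` at `0` with the `m` terms of degree `0, …, m - 1`. -/
def taylorSum (m : ℕ) (g : ℝ → ℝ) (t : ℝ) : ℝ :=
  ∑ k ∈ Finset.range m, iteratedDeriv k g 0 / (k.factorial : ℝ) * t ^ k

/-- The regularized value of `⟨t_+^l, g⟩`, meant for `-m - 1 < Re l` and `l ≠ -1, …, -m`
(its value does not depend on the choice of such an `m`). -/
def regularizedPairing (m : ℕ) (l : ℂ) (g : ℝ → ℝ) : ℂ :=
  (∫ t in Ioc (0 : ℝ) 1, (t : ℂ) ^ l * ((g t - taylorSum m g t : ℝ) : ℂ))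
    + (∫ t in Ioi (1 : ℝ), (t : ℂ) ^ l * (g t : ℂ))
    + ∑ k ∈ Finset.range m, ((iteratedDeriv k g 0 : ℝ) : ℂ) / ((k.factorial : ℂ) * (l + k + 1))

open Classical in
/-- The entire family of functionals `⟨t_+^l / Γ(l + 1), g⟩`, `l ∈ ℂ`.
With `m = ⌊-Re l⌋` (and `m = 0` if `Re l > 0`) one has `-m - 1 < Re l`, and `l` is one of
`-1, -2, …` exactly when `m ≥ 1` and `l = -m`; there the value is `(-1)^(m-1) g^(m-1)(0)`. -/
def normalizedPairing (l : ℂ) (g : ℝ → ℝ) : ℂ :=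
  if 1 ≤ ⌊-l.re⌋₊ ∧ l = -(⌊-l.re⌋₊ : ℂ) then
    (-1) ^ (⌊-l.re⌋₊ - 1) * ((iteratedDeriv (⌊-l.re⌋₊ - 1) g 0 : ℝ) : ℂ)
  else
    regularizedPairing ⌊-l.re⌋₊ l g / Complex.Gamma (l + 1)

/-- The fractional derivative `g^(q)(0) = ⟨t_+^(-q-1) / Γ(-q), g⟩` of order `q ∈ ℂ` at zero. -/
def fractionalDeriv (g : ℝ → ℝ) (q : ℂ) : ℂ :=
  normalizedPairing (-q - 1) g

/-- The functional `t_+^(-q-1) / Γ(-q)` can be applied to `g`: the function `g` is infinitely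
differentiable on a neighbourhood of zero, and the two integrals in the regularized pairing
converge absolutely. -/
structure IsFractionallyDifferentiable (g : ℝ → ℝ) (q : ℂ) : Prop where
  smooth_near_zero : ∃ U ∈ 𝓝 (0 : ℝ), ContDiffOn ℝ ∞ g U
  integrableOn_near_zero :
    IntegrableOn
      (fun t : ℝ => (t : ℂ) ^ (-q - 1) * ((g t - taylorSum ⌊-(-q - 1).re⌋₊ g t : ℝ) : ℂ))
      (Ioc 0 1)
  integrableOn_away_from_zero :
    IntegrableOn (fun t : ℝ => (t : ℂ) ^ (-q - 1) * (g t : ℂ)) (Ioi 1)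

/-! ### The Fourier transform, normalized without `2π` in the exponent -/

/-- The map `φ ↦ φ̂`, `φ̂(w) = ∫ φ(x) e^{-i⟨x,w⟩} dx`, on Schwartz functions, obtained from
Mathlib's transform (with kernel `e^{-2πi⟨x,w⟩}`) by rescaling. -/
def schwartzFourier (n : ℕ) :
    𝓢(EuclideanSpace ℝ (Fin n), ℂ) →L[ℂ] 𝓢(EuclideanSpace ℝ (Fin n), ℂ) :=
  (SchwartzMap.compCLMOfContinuousLinearEquiv ℂ
    (ContinuousLinearEquiv.smulLeft (M₁ := EuclideanSpace ℝ (Fin n)) (R₁ := ℝ)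
      (Units.mk0 ((2 * Real.pi)⁻¹ : ℝ) (by positivity)))) ∘L
    FourierTransform.fourierCLM ℂ 𝓢(EuclideanSpace ℝ (Fin n), ℂ)

theorem schwartzFourier_apply {n : ℕ} (φ : 𝓢(EuclideanSpace ℝ (Fin n), ℂ))
    (w : EuclideanSpace ℝ (Fin n)) :
    schwartzFourier n φ w = ∫ x, Complex.exp (-Complex.I * (inner ℝ x w : ℝ)) * φ x := by
  have h : schwartzFourier n φ w
      = 𝓕 (φ : EuclideanSpace ℝ (Fin n) → ℂ) ((2 * Real.pi)⁻¹ • w) := rfl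
  rw [h, Real.fourier_eq']
  refine integral_congr_ae (Eventually.of_forall fun x => ?_)
  have hpi : (Real.pi : ℂ) ≠ 0 := by exact_mod_cast Real.pi_ne_zero
  simp only [inner_smul_right, smul_eq_mul]
  congr 2
  push_cast
  field_simp

/-- The Fourier transform of a tempered distribution, `⟨T̂, φ⟩ = ⟨T, φ̂⟩`. -/
def distributionFourier {n : ℕ} (T : 𝓢'(EuclideanSpace ℝ (Fin n), ℂ)) :
    𝓢'(EuclideanSpace ℝ (Fin n), ℂ) :=
  PointwiseConvergenceCLM.precomp ℂ (schwartzFourier n) T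

theorem distributionFourier_apply {n : ℕ} (T : 𝓢'(EuclideanSpace ℝ (Fin n), ℂ))
    (φ : 𝓢(EuclideanSpace ℝ (Fin n), ℂ)) :
    distributionFourier T φ = T (schwartzFourier n φ) := rfl

/-- `T` is the tempered distribution `φ ↦ ∫ f φ` defined by the function `f`. -/
def IsDistributionOf {n : ℕ} (T : 𝓢'(EuclideanSpace ℝ (Fin n), ℂ))
    (f : EuclideanSpace ℝ (Fin n) → ℂ) : Prop :=
  ∀ φ : 𝓢(EuclideanSpace ℝ (Fin n), ℂ),
    Integrable (fun x => f x * φ x) ∧ T φ = ∫ x, f x * φ x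

/-- On `ℝⁿ \ {0}` the distribution `T` is the continuous function `G`. Such a `G` is determined
by `T` at every point of `ℝⁿ \ {0}`. -/
def IsContinuousFunctionOffZero {n : ℕ} (T : 𝓢'(EuclideanSpace ℝ (Fin n), ℂ))
    (G : EuclideanSpace ℝ (Fin n) → ℂ) : Prop :=
  ContinuousOn G {0}ᶜ ∧
    ∀ φ : 𝓢(EuclideanSpace ℝ (Fin n), ℂ), HasCompactSupport φ → tsupport φ ⊆ {0}ᶜ →
      T φ = ∫ x, G x * φ x

end

/-!
Write `N` for the Minkowski functional of `K`, `d = n - 1`, and fix a unit vector `ξ`. Neither side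
of the formula is touched directly. A smooth profile `η` with compact support in `(0, ∞)` turns `N`
into the Schwartz function `h = η ∘ N`, and everything is expressed by the Mellin transform
`M(q) = ∫_0^∞ u^q ĥ(u ξ) du`, which converges absolutely and is holomorphic for `Re q > -1`.

*The Fourier side.* For `p = -n + q + 1`, substituting `u = N(x) / s` shows that
`c N(x)^p = ∫_0^∞ u^(p-1) h(x / u) du` with `c = ∫_0^∞ η(s) s^(-p-1) ds`, so `c N^p` is a
superposition of dilates of `h`. Its Fourier transform is the superposition
`∫_0^∞ u^(p-1) u^n ĥ(u ξ) du` of their transforms, which converges off the origin and is continuous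
there: `c (N^p)^∧(ξ) = M(q)` (`IsSmoothGauge.distributionFourier_eq`). All that is asked of the
profile is `c ≠ 0` for the given `q` (`exists_mellin_ne_zero`).

*The section side.* By Fubini, `u ↦ ĥ(u ξ)` is the one-dimensional Fourier transform of the even
function `H(t) = ∫ h` over the hyperplane `ξ^⊥ + t ξ`, and by the layer-cake formula `H` is a
superposition of dilates of `A_ξ` (`IsSmoothGauge.sectionIntegral_eq`). In the strip
`-1 < Re q < 0` the Mellin transform of a cosine transform is
`2 Γ(q+1) cos((q+1)π/2) ∫_0^∞ t^(-q-1) H(t) dt` (`mellin_fourier_of_even`), and the last integral is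
`c (d - q) ∫_0^∞ t^(-q-1) A_ξ(t) dt`, hence `c (d - q) Γ(-q) A_ξ^(q)(0)`. With the reflection formula
for `Γ` this is the identity `c π (d - q) A_ξ^(q)(0) = cos(qπ/2) M(q)` in the strip. Both sides are
holomorphic in `Re q > -1`, the left one because `A_ξ` is smooth near `0`, so the identity extends
(`IsSmoothGauge.fractionalDeriv_sectionVolume`).

*Smoothness of `A_ξ` near zero.* For small `z` the section is star-shaped about `z ξ`, with a radial
function depending smoothly on the direction and on `z` by the implicit function theorem
(`IsSmoothGauge.exists_smooth_slope`). Polar coordinates and differentiation under the integral over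
the sphere of `ξ^⊥` then give `IsSmoothGauge.contDiffOn_sectionVolume`.
-/

/-! ### Smooth even gauges and star bodies -/

/-- A smooth even gauge: a positive function, homogeneous of degree one and even, which is `C^∞`
away from the origin. The Minkowski functional of a smooth symmetric star body is one
(`IsSymmetricStarBody.isSmoothGauge`), and the convexity of a norm is not asked for. -/
structure IsSmoothGauge {E : Type*} [NormedAddCommGroup E] [NormedSpace ℝ E] (N : E → ℝ) :
    Prop where
  contDiffOn : ContDiffOn ℝ ∞ N {0}ᶜ
  smul : ∀ a : ℝ, 0 ≤ a → ∀ x, N (a • x) = a * N x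
  neg : ∀ x, N (-x) = N x
  pos : ∀ x, x ≠ 0 → 0 < N x

namespace IsSmoothGauge

variable {E : Type*} [NormedAddCommGroup E] [NormedSpace ℝ E] {N : E → ℝ}

theorem zero (hN : IsSmoothGauge N) : N 0 = 0 := by
  simpa using hN.smul 0 le_rfl 0

theorem nonneg (hN : IsSmoothGauge N) (x : E) : 0 ≤ N x := by
  rcases eq_or_ne x 0 with rfl | hx
  · exact hN.zero.ge
  · exact (hN.pos x hx).le

theorem contDiffAt (hN : IsSmoothGauge N) {x : E} (hx : x ≠ 0) : ContDiffAt ℝ ∞ N x :=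
  hN.contDiffOn.contDiffAt (isOpen_compl_singleton.mem_nhds hx)

theorem eq_norm_mul (hN : IsSmoothGauge N) {x : E} (hx : x ≠ 0) :
    N x = ‖x‖ * N (‖x‖⁻¹ • x) := by
  rw [hN.smul _ (by positivity), mul_inv_cancel_left₀ (norm_ne_zero_iff.2 hx)]

variable [FiniteDimensional ℝ E]

theorem exists_le_norm (hN : IsSmoothGauge N) : ∃ C, 0 < C ∧ ∀ x, N x ≤ C * ‖x‖ := by
  have hc : ContinuousOn N (Metric.sphere 0 1) := hN.contDiffOn.continuousOn.mono
    fun x hx => by rintro rfl; simp at hx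
  obtain ⟨C, hC⟩ := (isCompact_sphere (0 : E) 1).bddAbove_image hc
  refine ⟨max C 1, by positivity, fun x => ?_⟩
  rcases eq_or_ne x 0 with rfl | hx
  · simp [hN.zero]
  · rw [hN.eq_norm_mul hx, mul_comm]
    refine mul_le_mul_of_nonneg_right (le_max_of_le_left (hC ⟨_, ?_, rfl⟩)) (norm_nonneg _)
    simp [norm_smul, hx]

theorem exists_norm_le (hN : IsSmoothGauge N) : ∃ c, 0 < c ∧ ∀ x, c * ‖x‖ ≤ N x := by
  have hs : Metric.sphere (0 : E) 1 ⊆ {0}ᶜ := fun x hx => by rintro rfl; simp at hx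
  have hc : ContinuousOn N (Metric.sphere 0 1) := hN.contDiffOn.continuousOn.mono hs
  rcases (Metric.sphere (0 : E) 1).eq_empty_or_nonempty with he | hne
  · refine ⟨1, one_pos, fun x => ?_⟩
    rcases eq_or_ne x 0 with rfl | hx
    · simp [hN.zero]
    · have : ‖x‖⁻¹ • x ∈ Metric.sphere (0 : E) 1 := by simp [norm_smul, hx]
      simp [he] at this
  obtain ⟨y, hy, hmin⟩ := (isCompact_sphere (0 : E) 1).exists_isMinOn hne hc
  refine ⟨N y, hN.pos y (hs hy), fun x => ?_⟩
  rcases eq_or_ne x 0 with rfl | hx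
  · simp [hN.zero]
  · rw [hN.eq_norm_mul hx, mul_comm]
    refine mul_le_mul_of_nonneg_left (hmin ?_) (norm_nonneg _)
    simp [norm_smul, hx]

theorem continuous (hN : IsSmoothGauge N) : Continuous N := by
  rw [continuous_iff_continuousAt]
  intro x
  rcases eq_or_ne x 0 with rfl | hx
  · obtain ⟨C, -, hC⟩ := hN.exists_le_norm
    have h0 : Tendsto (fun x : E => C * ‖x‖) (𝓝 0) (𝓝 0) := by
      have : Continuous fun x : E => C * ‖x‖ := by fun_prop
      simpa using this.tendsto 0
    simpa [ContinuousAt, hN.zero] using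
      tendsto_of_tendsto_of_tendsto_of_le_of_le tendsto_const_nhds h0 hN.nonneg hC
  · exact (hN.contDiffAt hx).continuousAt

theorem isCompact_setOf_le (hN : IsSmoothGauge N) (a : ℝ) : IsCompact {x | N x ≤ a} := by
  obtain ⟨c, hc, hle⟩ := hN.exists_norm_le
  refine (isCompact_closedBall (0 : E) (a / c)).of_isClosed_subset
    (isClosed_le hN.continuous continuous_const) fun x hx => ?_
  rw [mem_closedBall_zero_iff, le_div_iff₀ hc, mul_comm]
  exact (hle x).trans hx

/-- A smooth profile of the gauge, supported in a compact subset of `(0, ∞)`, is smooth also at the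
origin, since it vanishes near it. -/
theorem contDiff_comp (hN : IsSmoothGauge N) {η : ℝ → ℝ} (hη : ContDiff ℝ ∞ η)
    (hsupp : tsupport η ⊆ Ioi 0) : ContDiff ℝ ∞ fun x => η (N x) := by
  rw [contDiff_iff_contDiffAt]
  intro x
  rcases eq_or_ne x 0 with rfl | hx
  · have h0 : N 0 ∉ tsupport η := fun h => by simpa [hN.zero] using hsupp h
    have : (fun x => η (N x)) =ᶠ[𝓝 0] fun _ => 0 :=
      hN.continuous.continuousAt.eventually (notMem_tsupport_iff_eventuallyEq.1 h0)
    exact contDiffAt_const.congr_of_eventuallyEq this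
  · exact hη.contDiffAt.comp x (hN.contDiffAt hx)

theorem hasCompactSupport_comp (hN : IsSmoothGauge N) {η : ℝ → ℝ} (hη : HasCompactSupport η) :
    HasCompactSupport fun x => η (N x) := by
  obtain ⟨R, hR⟩ := hη.isCompact.bddAbove
  refine HasCompactSupport.intro (hN.isCompact_setOf_le R) fun x hx => ?_
  by_contra h
  exact hx (hR (subset_tsupport _ h))

end IsSmoothGauge

namespace IsSymmetricStarBody

variable {n : ℕ} {K : Set (EuclideanSpace ℝ (Fin n))}

theorem exists_pos_smul_mem (hK : IsSymmetricStarBody K) {x : EuclideanSpace ℝ (Fin n)}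
    (hx : x ≠ 0) : ∃ a : ℝ, 0 < a ∧ a • x ∈ K := by
  have hθ : ‖x‖⁻¹ • x ∈ Metric.sphere (0 : EuclideanSpace ℝ (Fin n)) 1 := by
    simp [norm_smul, hx]
  have hne : {a : ℝ | 0 < a ∧ a • ‖x‖⁻¹ • x ∈ K}.Nonempty := by
    by_contra h
    -- the supremum of the empty set is `0`, against the positivity of the radial function
    have := hK.radial_pos _ hθ
    rw [radialFunction, not_nonempty_iff_eq_empty.1 h, Real.sSup_empty] at this
    exact this.false
  obtain ⟨a, ha, hak⟩ := hne
  refine ⟨a * ‖x‖⁻¹, by positivity, by rwa [← smul_smul]⟩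

/-- The body is recovered from its Minkowski functional: the infimum is attained by compactness. -/
theorem gauge_le_one_iff (hK : IsSymmetricStarBody K) (hn : 0 < n)
    (x : EuclideanSpace ℝ (Fin n)) : gauge K x ≤ 1 ↔ x ∈ K := by
  refine ⟨fun h => ?_, gauge_le_one_of_mem⟩
  have : NeZero n := ⟨hn.ne'⟩
  have hne : K.Nonempty := by
    obtain ⟨e, he⟩ := exists_ne (0 : EuclideanSpace ℝ (Fin n))
    obtain ⟨a, -, ha⟩ := hK.exists_pos_smul_mem he
    exact ⟨_, ha⟩
  have h0 : (0 : EuclideanSpace ℝ (Fin n)) ∈ K := hK.starConvex.mem hne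
  rcases eq_or_ne x 0 with rfl | hx
  · exact h0
  have hmem : ∀ r : ℝ, 1 < r → r⁻¹ • x ∈ K := by
    intro r hr
    have hS : {s : ℝ | s ∈ Ioi 0 ∧ s⁻¹ • x ∈ K}.Nonempty := by
      obtain ⟨a, ha, hak⟩ := hK.exists_pos_smul_mem hx
      exact ⟨a⁻¹, by simpa using ha, by simpa using hak⟩
    have hlt : gauge K x < r := h.trans_lt hr
    rw [gauge_def'] at hlt
    obtain ⟨s, ⟨hs, hsK⟩, hsr⟩ := exists_lt_of_csInf_lt hS hlt
    have hs : 0 < s := hs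
    have h1 : r⁻¹ • x = (r⁻¹ * s) • s⁻¹ • x := by
      rw [smul_smul, mul_assoc, mul_inv_cancel₀ hs.ne', mul_one]
    rw [h1]
    refine hK.starConvex.smul_mem hsK (by positivity) ?_
    rw [inv_mul_le_iff₀ (by positivity), mul_one]
    exact hsr.le
  have hlim : Tendsto (fun r : ℝ => r⁻¹ • x) (𝓝[>] 1) (𝓝 x) := by
    have : ContinuousAt (fun r : ℝ => r⁻¹ • x) 1 :=
      (continuousAt_inv₀ one_ne_zero).smul continuousAt_const
    simpa using this.tendsto.mono_left nhdsWithin_le_nhds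
  exact hK.isCompact.isClosed.mem_of_tendsto hlim
    (eventually_mem_nhdsWithin.mono fun r hr => hmem r hr)

theorem isSmoothGauge (hK : IsSymmetricStarBody K) (hsmooth : HasSmoothBoundary K) :
    IsSmoothGauge (gauge K) where
  contDiffOn := hsmooth
  smul a ha x := by simpa using gauge_smul_of_nonneg (s := K) ha x
  neg x := gauge_neg hK.symmetric x
  pos x hx := by
    obtain ⟨R, hR⟩ := hK.isCompact.isBounded.subset_closedBall (0 : EuclideanSpace ℝ (Fin n))
    have hS : {s : ℝ | s ∈ Ioi 0 ∧ s⁻¹ • x ∈ K}.Nonempty := by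
      obtain ⟨a, ha, hak⟩ := hK.exists_pos_smul_mem hx
      exact ⟨a⁻¹, by simpa using ha, by simpa using hak⟩
    have hx0 : 0 < ‖x‖ := norm_pos_iff.2 hx
    refine lt_of_lt_of_le (b := ‖x‖ / (max R 1)) (by positivity) ?_
    rw [gauge_def']
    refine le_csInf hS fun s ⟨hs, hsK⟩ => ?_
    have hs : 0 < s := hs
    have h1 := hR hsK
    rw [mem_closedBall_zero_iff, norm_smul, norm_inv, Real.norm_of_nonneg hs.le,
      inv_mul_le_iff₀ hs] at h1
    rw [div_le_iff₀ (by positivity)]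
    exact h1.trans (mul_le_mul_of_nonneg_left (le_max_left _ _) hs.le)

end IsSymmetricStarBody

/-! ### Differentiation under an integral over a compact space -/

section ParametricIntegral

variable {S V : Type*} [TopologicalSpace S] [CompactSpace S] [MeasurableSpace S]
  [OpensMeasurableSpace S] {σ : Measure S} [IsFiniteMeasure σ]
  [NormedAddCommGroup V] [NormedSpace ℝ V] {ι : S → V} {u : V × ℝ → ℝ} {Ω : Set (V × ℝ)}
  {I : Set ℝ}

theorem hasDerivAt_integral_of_contDiffOn (hι : Continuous ι) (hΩ : IsOpen Ω) (hI : IsOpen I)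
    (hu : ContDiffOn ℝ ∞ u Ω) (hmem : ∀ s, ∀ z ∈ I, (ι s, z) ∈ Ω) {z : ℝ} (hz : z ∈ I) :
    HasDerivAt (fun z => ∫ s, u (ι s, z) ∂σ) (∫ s, fderiv ℝ u (ι s, z) (0, 1) ∂σ) z := by
  obtain ⟨ε, hε, hεI⟩ := Metric.nhds_basis_closedBall.mem_iff.1 (hI.mem_nhds hz)
  have hu' : ContinuousOn (fun x => fderiv ℝ u x (0, 1)) Ω :=
    (hu.continuousOn_fderiv_of_isOpen hΩ (by simp)).clm_apply continuousOn_const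
  have hcont : ∀ (f : V × ℝ → ℝ), ContinuousOn f Ω → ∀ w ∈ I, Continuous fun s => f (ι s, w) := by
    intro f hf w hw
    exact hf.comp_continuous (by fun_prop) fun s => hmem s w hw
  have hbd : ∃ C, ∀ s, ∀ w ∈ Metric.closedBall z ε, ‖fderiv ℝ u (ι s, w) (0, 1)‖ ≤ C := by
    have hcpt : IsCompact ((univ : Set S) ×ˢ Metric.closedBall z ε) :=
      isCompact_univ.prod (isCompact_closedBall z ε)
    have hc : ContinuousOn (fun x : S × ℝ => fderiv ℝ u (ι x.1, x.2) (0, 1))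
        (univ ×ˢ Metric.closedBall z ε) :=
      hu'.comp (by fun_prop) fun x hx => hmem _ _ (hεI hx.2)
    obtain ⟨C, hC⟩ := hcpt.exists_bound_of_continuousOn hc
    exact ⟨C, fun s w hw => hC (s, w) ⟨mem_univ _, hw⟩⟩
  obtain ⟨C, hC⟩ := hbd
  refine (hasDerivAt_integral_of_dominated_loc_of_deriv_le
    (F := fun z s => u (ι s, z)) (F' := fun z s => fderiv ℝ u (ι s, z) (0, 1))
    (bound := fun _ => C) (Metric.closedBall_mem_nhds z hε) ?_ ?_ ?_ ?_ ?_ ?_).2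
  · filter_upwards [hI.mem_nhds hz] with w hw
    exact (hcont u hu.continuousOn w hw).aestronglyMeasurable
  · obtain ⟨B, hB⟩ := (isCompact_univ (X := S)).exists_bound_of_continuousOn
      (hcont u hu.continuousOn z hz).continuousOn
    exact Integrable.of_bound (hcont u hu.continuousOn z hz).aestronglyMeasurable B
      (Eventually.of_forall fun s => hB s (mem_univ s))
  · exact (hcont _ hu' z hz).aestronglyMeasurable
  · exact Eventually.of_forall fun s w hw => hC s w hw
  · exact integrable_const C
  · refine Eventually.of_forall fun s w hw => ?_
    have h1 : HasFDerivAt u (fderiv ℝ u (ι s, w)) (ι s, w) :=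
      ((hu.contDiffAt (hΩ.mem_nhds (hmem s w (hεI hw)))).differentiableAt (by simp)).hasFDerivAt
    have h2 : HasDerivAt (fun w : ℝ => (ι s, w)) ((0 : V), (1 : ℝ)) w :=
      (hasDerivAt_const w (ι s)).prodMk (hasDerivAt_id w)
    exact h1.comp_hasDerivAt w h2

/-- Differentiation under an integral over a compact space, to all orders. -/
theorem contDiffOn_integral_of_contDiffOn (hι : Continuous ι) (hΩ : IsOpen Ω) (hI : IsOpen I)
    (hu : ContDiffOn ℝ ∞ u Ω) (hmem : ∀ s, ∀ z ∈ I, (ι s, z) ∈ Ω) :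
    ContDiffOn ℝ ∞ (fun z => ∫ s, u (ι s, z) ∂σ) I := by
  rw [contDiffOn_infty]
  intro k
  induction k generalizing u with
  | zero =>
    exact contDiffOn_zero.2 fun z hz =>
      (hasDerivAt_integral_of_contDiffOn hι hΩ hI hu hmem hz).continuousAt.continuousWithinAt
  | succ k ih =>
    have hd : ∀ z ∈ I, HasDerivAt (fun z => ∫ s, u (ι s, z) ∂σ)
        (∫ s, fderiv ℝ u (ι s, z) (0, 1) ∂σ) z := fun z hz =>
      hasDerivAt_integral_of_contDiffOn hι hΩ hI hu hmem hz
    rw [Nat.cast_succ, contDiffOn_succ_iff_deriv_of_isOpen hI]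
    refine ⟨fun z hz => (hd z hz).differentiableAt.differentiableWithinAt, by simp, ?_⟩
    refine (ih (u := fun x => fderiv ℝ u x (0, 1)) ?_).congr fun z hz => (hd z hz).deriv
    exact (hu.fderiv_of_isOpen hΩ (by simp)).clm_apply contDiffOn_const

end ParametricIntegral

/-! ### The sections near the central hyperplane as radial graphs -/

section Slice

variable {E : Type*} [NormedAddCommGroup E] [InnerProductSpace ℝ E] {ξ : E}

theorem norm_sq_orthogonal_add_smul (hξ : ‖ξ‖ = 1) (v : (ℝ ∙ ξ)ᗮ) (w : ℝ) :
    ‖(v : E) + w • ξ‖ ^ 2 = ‖v‖ ^ 2 + w ^ 2 := by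
  have h : inner ℝ (v : E) (w • ξ) = 0 := by
    rw [real_inner_comm]
    exact Submodule.inner_right_of_mem_orthogonal
      (Submodule.smul_mem _ _ (Submodule.mem_span_singleton_self ξ)) v.2
  have := norm_add_sq_real (v : E) (w • ξ)
  rw [h, norm_smul, hξ] at this
  simpa [sq_abs] using this

theorem norm_le_norm_orthogonal_add_smul (hξ : ‖ξ‖ = 1) (v : (ℝ ∙ ξ)ᗮ) (w : ℝ) :
    ‖v‖ ≤ ‖(v : E) + w • ξ‖ := by
  nlinarith [norm_sq_orthogonal_add_smul hξ v w, norm_nonneg v, norm_nonneg ((v : E) + w • ξ),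
    sq_nonneg w]

variable [FiniteDimensional ℝ E] {N : E → ℝ}

/-- Near the central hyperplane the boundary of a section, seen from its centre, is a smooth radial
graph. On the ray through `v` the boundary point at height `z` is proportional to `v + w ξ`, where
`w` is the root of `w = z N(v + w ξ)`; for small `z` the right-hand side is a contraction in `w`, so
the root is unique, and smooth by the implicit function theorem. -/
theorem IsSmoothGauge.exists_smooth_slope (hN : IsSmoothGauge N) (hξ : ‖ξ‖ = 1) :
    ∃ δ > 0, ∃ w : (ℝ ∙ ξ)ᗮ × ℝ → ℝ,
      ContDiffOn ℝ ∞ w {x | ‖x.1‖ ∈ Ioo (1 / 2 : ℝ) 2 ∧ x.2 ∈ Ioo (-δ) δ} ∧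
      ∀ v : (ℝ ∙ ξ)ᗮ, ‖v‖ ∈ Ioo (1 / 2 : ℝ) 2 → ∀ z ∈ Ioo (-δ) δ, ∀ r > 0,
        (N (r • (v : E) + z • ξ) ≤ 1 ↔ r * N (v + w (v, z) • ξ) ≤ 1) := by
  -- the points `v + w ξ` with `1 / 2 < ‖v‖ < 2` and `|w| ≤ 1` lie in a compact shell
  have hshell : ∀ v : (ℝ ∙ ξ)ᗮ, ‖v‖ ∈ Ioo (1 / 2 : ℝ) 2 → ∀ w ∈ Icc (-1 : ℝ) 1,
      (v : E) + w • ξ ∈ Metric.closedBall (0 : E) 3 \ Metric.ball 0 (1 / 2) := by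
    intro v hv w hw
    have h1 := norm_le_norm_orthogonal_add_smul hξ v w
    have h2 : ‖(v : E) + w • ξ‖ ≤ ‖(v : E)‖ + |w| := by
      simpa [norm_smul, hξ] using norm_add_le (v : E) (w • ξ)
    have h3 : |w| ≤ 1 := abs_le.2 hw
    have h4 : ‖(v : E)‖ = ‖v‖ := rfl
    simp only [Set.mem_sdiff, Metric.mem_closedBall, dist_zero_right, Metric.mem_ball, not_lt]
    exact ⟨by linarith [hv.2], by linarith [hv.1]⟩
  have hshell0 : Metric.closedBall (0 : E) 3 \ Metric.ball 0 (1 / 2) ⊆ {0}ᶜ := by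
    rintro x ⟨-, hx⟩ rfl
    simp at hx
  have hshellc : IsCompact (Metric.closedBall (0 : E) 3 \ Metric.ball 0 (1 / 2)) :=
    (isCompact_closedBall 0 3).diff Metric.isOpen_ball
  obtain ⟨M, hM⟩ := hshellc.exists_bound_of_continuousOn
    (hN.contDiffOn.continuousOn.mono hshell0)
  obtain ⟨L, hL⟩ := hshellc.exists_bound_of_continuousOn
    ((hN.contDiffOn.continuousOn_fderiv_of_isOpen isOpen_compl_singleton (by simp)).mono hshell0)
  obtain ⟨C, hC, hNC⟩ := hN.exists_le_norm
  obtain ⟨δ, hδ, hδM, hδL, hδC⟩ : ∃ δ > 0, δ * (|M| + 1) < 1 ∧ δ * (|L| + 1) < 1 ∧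
      δ * (3 * C) < 1 := by
    refine ⟨(|M| + |L| + 3 * C + 2)⁻¹, by positivity, ?_, ?_, ?_⟩ <;>
    · rw [inv_mul_lt_iff₀ (by positivity)]
      linarith [abs_nonneg M, abs_nonneg L]
  set f : (ℝ ∙ ξ)ᗮ → ℝ → ℝ → ℝ := fun v z w => w - z * N (v + w • ξ) with hf
  have hder : ∀ v : (ℝ ∙ ξ)ᗮ, ‖v‖ ∈ Ioo (1 / 2 : ℝ) 2 → ∀ z, ∀ w ∈ Icc (-1 : ℝ) 1,
      HasDerivAt (f v z) (1 - z * fderiv ℝ N (v + w • ξ) ξ) w := by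
    intro v hv z w hw
    have h1 : HasFDerivAt N (fderiv ℝ N (v + w • ξ)) (v + w • ξ) :=
      ((hN.contDiffAt (hshell0 (hshell v hv w hw))).differentiableAt (by simp)).hasFDerivAt
    have h2 : HasDerivAt (fun w : ℝ => (v : E) + w • ξ) ξ w := by
      simpa using ((hasDerivAt_id w).smul_const ξ).const_add (v : E)
    exact (hasDerivAt_id w).sub ((h1.comp_hasDerivAt w h2).const_mul z)
  have hpos : ∀ v : (ℝ ∙ ξ)ᗮ, ‖v‖ ∈ Ioo (1 / 2 : ℝ) 2 → ∀ z ∈ Ioo (-δ) δ,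
      ∀ w ∈ Icc (-1 : ℝ) 1, 0 < 1 - z * fderiv ℝ N (v + w • ξ) ξ := by
    intro v hv z hz w hw
    have h1 : ‖fderiv ℝ N (v + w • ξ) ξ‖ ≤ |L| := by
      have := (fderiv ℝ N (v + w • ξ)).le_opNorm ξ
      rw [hξ, mul_one] at this
      exact this.trans ((hL _ (hshell v hv w hw)).trans (le_abs_self L))
    have h2 : |z * fderiv ℝ N (v + w • ξ) ξ| ≤ δ * (|L| + 1) := by
      rw [abs_mul]
      refine mul_le_mul (abs_le.2 ⟨hz.1.le, hz.2.le⟩) ?_ (abs_nonneg _) hδ.le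
      rw [Real.norm_eq_abs] at h1
      linarith
    linarith [le_abs_self (z * fderiv ℝ N (v + w • ξ) ξ)]
  have hmono : ∀ v : (ℝ ∙ ξ)ᗮ, ‖v‖ ∈ Ioo (1 / 2 : ℝ) 2 → ∀ z ∈ Ioo (-δ) δ,
      StrictMonoOn (f v z) (Icc (-1) 1) := by
    intro v hv z hz
    refine strictMonoOn_of_deriv_pos (convex_Icc _ _)
      (fun w hw => (hder v hv z w hw).continuousAt.continuousWithinAt) fun w hw => ?_
    rw [interior_Icc] at hw
    have hw' := Ioo_subset_Icc_self hw
    rw [(hder v hv z w hw').deriv]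
    exact hpos v hv z hz w hw'
  have hsmall : ∀ v : (ℝ ∙ ξ)ᗮ, ‖v‖ ∈ Ioo (1 / 2 : ℝ) 2 → ∀ z ∈ Ioo (-δ) δ,
      ∀ w ∈ Icc (-1 : ℝ) 1, |z * N (v + w • ξ)| < 1 := by
    intro v hv z hz w hw
    refine lt_of_le_of_lt ?_ hδM
    rw [abs_mul]
    refine mul_le_mul (abs_le.2 ⟨hz.1.le, hz.2.le⟩) ?_ (abs_nonneg _) hδ.le
    have := (hM _ (hshell v hv w hw)).trans (le_abs_self M)
    rw [Real.norm_eq_abs] at this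
    linarith
  have hex : ∀ x : (ℝ ∙ ξ)ᗮ × ℝ, ∃ w : ℝ, ‖x.1‖ ∈ Ioo (1 / 2 : ℝ) 2 → x.2 ∈ Ioo (-δ) δ →
      w ∈ Ioo (-1 : ℝ) 1 ∧ f x.1 x.2 w = 0 := by
    rintro ⟨v, z⟩
    by_cases hv : ‖v‖ ∈ Ioo (1 / 2 : ℝ) 2
    swap
    · exact ⟨0, fun h => (hv h).elim⟩
    by_cases hz : z ∈ Ioo (-δ) δ
    swap
    · exact ⟨0, fun _ h => (hz h).elim⟩
    have hc : ContinuousOn (f v z) (Icc (-1) 1) :=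
      fun w hw => (hder v hv z w hw).continuousAt.continuousWithinAt
    have h1 := abs_lt.1 (hsmall v hv z hz 1 (by simp))
    have h2 := abs_lt.1 (hsmall v hv z hz (-1) (by simp))
    obtain ⟨w, hw, hw0⟩ := intermediate_value_Ioo (by norm_num) hc
      (show (0 : ℝ) ∈ Ioo (f v z (-1)) (f v z 1) from
        ⟨by simp only [hf]; linarith, by simp only [hf]; linarith⟩)
    exact ⟨w, fun _ _ => ⟨hw, hw0⟩⟩
  choose w hw using hex
  refine ⟨δ, hδ, w, ?_, ?_⟩
  · rintro ⟨v, z⟩ ⟨hv, hz⟩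
    obtain ⟨hwI, hw0⟩ := hw (v, z) hv hz
    set F : ((ℝ ∙ ξ)ᗮ × ℝ) × ℝ → ℝ := fun p => f p.1.1 p.1.2 p.2 with hF
    have hx0 := hshell0 (hshell v hv _ (Ioo_subset_Icc_self hwI))
    have hFd : ContDiffAt ℝ ∞ F ((v, z), w (v, z)) := by
      have h1 : ContDiffAt ℝ ∞ (fun p : ((ℝ ∙ ξ)ᗮ × ℝ) × ℝ => (p.1.1 : E) + p.2 • ξ)
          ((v, z), w (v, z)) := by
        have : ContDiff ℝ ∞ (fun p : ((ℝ ∙ ξ)ᗮ × ℝ) × ℝ => ((ℝ ∙ ξ)ᗮ.subtypeL p.1.1) + p.2 • ξ) := by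
          fun_prop
        exact this.contDiffAt
      have h2 : ContDiffAt ℝ ∞ (fun p : ((ℝ ∙ ξ)ᗮ × ℝ) × ℝ => N ((p.1.1 : E) + p.2 • ξ))
          ((v, z), w (v, z)) :=
        ContDiffAt.comp (g := N) _ (hN.contDiffAt hx0) h1
      have h3 : ContDiffAt ℝ ∞ (fun p : ((ℝ ∙ ξ)ᗮ × ℝ) × ℝ => p.1.2) ((v, z), w (v, z)) := by
        fun_prop
      exact contDiffAt_snd.sub (h3.mul h2)
    have hinr : (fderiv ℝ F ((v, z), w (v, z)) ∘L .inr ℝ _ _) =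
        ((ContinuousLinearEquiv.unitsEquivAut ℝ (Units.mk0 _
          (hpos v hv z hz _ (Ioo_subset_Icc_self hwI)).ne') : ℝ ≃L[ℝ] ℝ) : ℝ →L[ℝ] ℝ) := by
      ext
      have h1 : HasFDerivAt F (fderiv ℝ F ((v, z), w (v, z))) ((v, z), w (v, z)) :=
        (hFd.differentiableAt (by simp)).hasFDerivAt
      have h2 : HasDerivAt (fun t : ℝ => ((v, z), t)) ((0 : (ℝ ∙ ξ)ᗮ × ℝ), (1 : ℝ)) (w (v, z)) :=
        (hasDerivAt_const _ _).prodMk (hasDerivAt_id _)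
      have h3 := (h1.comp_hasDerivAt _ h2).unique
        (hder v hv z _ (Ioo_subset_Icc_self hwI))
      simpa using h3
    have hinv : (fderiv ℝ F ((v, z), w (v, z)) ∘L .inr ℝ _ _).IsInvertible := by
      rw [hinr]
      exact ContinuousLinearMap.isInvertible_equiv
    set ψ := hFd.implicitFunction (by simp) hinv
    have hψ : ContDiffAt ℝ ∞ ψ (v, z) := hFd.contDiffAt_implicitFunction (by simp) hinv
    have hψ0 : ψ (v, z) = w (v, z) := hFd.implicitFunction_apply_self (by simp) hinv
    have hψF := hFd.eventually_apply_implicitFunction (by simp) hinv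
    refine (hψ.congr_of_eventuallyEq ?_).contDiffWithinAt
    have hψI : ∀ᶠ x in 𝓝 (v, z), ψ x ∈ Ioo (-1 : ℝ) 1 :=
      hψ.continuousAt.eventually (isOpen_Ioo.mem_nhds (by rw [hψ0]; exact hwI))
    have hev : ∀ᶠ x : (ℝ ∙ ξ)ᗮ × ℝ in 𝓝 (v, z),
        ‖x.1‖ ∈ Ioo (1 / 2 : ℝ) 2 ∧ x.2 ∈ Ioo (-δ) δ :=
      ((continuous_fst.norm.isOpen_preimage _ isOpen_Ioo).inter
        (continuous_snd.isOpen_preimage _ isOpen_Ioo)).mem_nhds ⟨hv, hz⟩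
    filter_upwards [hψI, hψF, hev] with x h1 h2 h3
    obtain ⟨h4, h5⟩ := hw x h3.1 h3.2
    refine (hmono x.1 h3.1 x.2 h3.2).injOn (Ioo_subset_Icc_self h4) (Ioo_subset_Icc_self h1) ?_
    rw [h5]
    exact (h2.trans hw0).symm
  · intro v hv z hz r hr
    obtain ⟨hwI, hw0⟩ := hw (v, z) hv hz
    have hw1 : w (v, z) = z * N (v + w (v, z) • ξ) := sub_eq_zero.1 hw0
    have hx0 := hshell0 (hshell v hv _ (Ioo_subset_Icc_self hwI))
    have hNpos := hN.pos _ hx0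
    by_cases hzr : z / r ∈ Icc (-1 : ℝ) 1
    · have hNr : N (r • (v : E) + z • ξ) = r * N (v + (z / r) • ξ) := by
        rw [← hN.smul r hr.le, smul_add, smul_smul, mul_div_cancel₀ _ hr.ne']
      have hle := (hmono v hv z hz).le_iff_le (Ioo_subset_Icc_self hwI) hzr
      have hle' := (hmono v hv z hz).le_iff_le hzr (Ioo_subset_Icc_self hwI)
      simp only [] at hw0
      rw [hw0] at hle hle'
      have hzr' : z / r * r = z := div_mul_cancel₀ _ hr.ne'
      rw [hNr]
      set a := N (v + (z / r) • ξ)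
      set b := N (v + w (v, z) • ξ)
      have hfa : f v z (z / r) = z / r - z * a := rfl
      rw [hfa, hw1] at hle hle'
      have hzq : z / r = z * r⁻¹ := div_eq_mul_inv _ _
      rw [← le_inv_mul_iff₀ hr, ← le_inv_mul_iff₀ hr, mul_one]
      rcases lt_trichotomy z 0 with hz0 | hz0 | hz0
      · rw [sub_nonpos, hzq, mul_le_mul_left_of_neg hz0, mul_le_mul_left_of_neg hz0] at hle'
        exact hle'
      · have : a = b := by
          have hw2 : w (v, z) = 0 := by rw [hw1, hz0, zero_mul]
          simp only [a, b]
          rw [hw2, hz0, zero_div]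
        rw [this]
      · rw [sub_nonneg, hzq, mul_le_mul_iff_right₀ hz0, mul_le_mul_iff_right₀ hz0] at hle
        exact hle
    · have hrz : r < |z| := by
        by_contra! h
        exact hzr (abs_le.1 (by rw [abs_div, abs_of_pos hr]; exact (div_le_one hr).2 h))
      have hzδ : |z| < δ := abs_lt.2 hz
      constructor <;> intro
      · have h1 : |z| * N (v + w (v, z) • ξ) < 1 := by
          have := abs_lt.2 hwI
          rw [← abs_of_pos hNpos, ← abs_mul, ← hw1]
          exact this
        nlinarith
      · refine (hNC _).trans ?_
        have : ‖r • (v : E) + z • ξ‖ ≤ 3 * δ := by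
          refine (norm_add_le _ _).trans ?_
          rw [norm_smul, norm_smul, hξ, Real.norm_of_nonneg hr.le, Real.norm_eq_abs]
          have : ‖(v : E)‖ < 2 := hv.2
          nlinarith
        nlinarith

end Slice

/-! ### Smoothness of the parallel section function -/

section Polar

theorem volumeIoiPow_apply_Iic (n : ℕ) (x : Ioi (0 : ℝ)) :
    Measure.volumeIoiPow n (Iic x) = ENNReal.ofReal (x.1 ^ (n + 1) / (n + 1)) := by
  rw [← Measure.volumeIoiPow_apply_Iio]
  have h0 : Measure.volumeIoiPow n {x} = 0 := by
    refine withDensity_absolutelyContinuous _ _ ?_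
    rw [comap_subtype_coe_apply measurableSet_Ioi]
    simp
  rw [← Iio_union_right]
  exact le_antisymm ((measure_union_le _ _).trans (by rw [h0, add_zero]))
    (measure_mono subset_union_left)

/-- The volume of a star-shaped set in terms of its radial function `ρ`. -/
theorem volume_real_eq_integral_radial {V : Type*} [NormedAddCommGroup V] [InnerProductSpace ℝ V]
    [FiniteDimensional ℝ V] [MeasurableSpace V] [BorelSpace V] [Nontrivial V] {B : Set V}
    {ρ : Metric.sphere (0 : V) 1 → ℝ} (hρ : Continuous ρ)
    (hpos : ∀ θ, 0 < ρ θ) (hmem : ∀ θ : Metric.sphere (0 : V) 1, ∀ r > 0,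
      (r • (θ : V) ∈ B ↔ r ≤ ρ θ)) :
    volume.real B = ∫ θ, ρ θ ^ Module.finrank ℝ V / Module.finrank ℝ V
      ∂(volume : Measure V).toSphere := by
  have hd : 0 < Module.finrank ℝ V := Module.finrank_pos
  have h1 : volume B = (volume : Measure V).comap (Subtype.val : ({0}ᶜ : Set V) → V)
      (Subtype.val ⁻¹' B) := by
    rw [comap_subtype_coe_apply (measurableSet_singleton _).compl, Subtype.image_preimage_coe,
      inter_comm]
    exact (measure_sdiff_null (measure_singleton 0)).symm
  have hmeas : MeasurableSet {p : Metric.sphere (0 : V) 1 × Ioi (0 : ℝ) | (p.2 : ℝ) ≤ ρ p.1} :=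
    measurableSet_le (measurable_subtype_coe.comp measurable_snd) (hρ.measurable.comp measurable_fst)
  have h2 : (Subtype.val ⁻¹' B : Set ({0}ᶜ : Set V)) =
      homeomorphUnitSphereProd V ⁻¹' {p | (p.2 : ℝ) ≤ ρ p.1} := by
    ext x
    have hx : 0 < ‖(x : V)‖ := norm_pos_iff.2 x.2
    have := hmem (homeomorphUnitSphereProd V x).1 _ (homeomorphUnitSphereProd V x).2.2
    rw [mem_preimage, mem_preimage, mem_ofPred_eq, ← this]
    simp [smul_smul, hx.ne']
  have h3 : volume B = ∫⁻ θ, ENNReal.ofReal (ρ θ ^ Module.finrank ℝ V / Module.finrank ℝ V)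
      ∂(volume : Measure V).toSphere := by
    rw [h1, h2, (Measure.measurePreserving_homeomorphUnitSphereProd volume).measure_preimage
      hmeas.nullMeasurableSet, Measure.prod_apply hmeas]
    refine lintegral_congr fun θ => ?_
    have : Prod.mk θ ⁻¹' {p : Metric.sphere (0 : V) 1 × Ioi (0 : ℝ) | (p.2 : ℝ) ≤ ρ p.1} =
        Iic ⟨ρ θ, hpos θ⟩ := by
      ext r
      simp [← Subtype.coe_le_coe]
    rw [this, volumeIoiPow_apply_Iic, Nat.sub_add_cancel hd, ← Nat.cast_add_one,
      Nat.sub_add_cancel hd]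
  rw [Measure.real, h3, integral_eq_lintegral_of_nonneg_ae]
  · exact Eventually.of_forall fun θ => by have := hpos θ; positivity
  · exact ((hρ.pow _).div_const _).aestronglyMeasurable

end Polar

section Section

variable {E : Type*} [NormedAddCommGroup E] [InnerProductSpace ℝ E] [FiniteDimensional ℝ E]
  [MeasurableSpace E] [BorelSpace E] {ξ : E} {N : E → ℝ}

/-- The parallel section function of the body `{N ≤ 1}`. -/
noncomputable def sectionVolume (N : E → ℝ) (ξ : E) (z : ℝ) : ℝ :=
  (volume : Measure (ℝ ∙ ξ)ᗮ).real {y | N (y + z • ξ) ≤ 1}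

theorem IsSmoothGauge.contDiffOn_sectionVolume (hN : IsSmoothGauge N) (hξ : ‖ξ‖ = 1) :
    ∃ δ > 0, ContDiffOn ℝ ∞ (sectionVolume N ξ) (Ioo (-δ) δ) := by
  rcases subsingleton_or_nontrivial (ℝ ∙ ξ)ᗮ with hV | hV
  · obtain ⟨C, hC, hNC⟩ := hN.exists_le_norm
    refine ⟨C⁻¹, by positivity, (contDiffOn_const (c := (volume : Measure (ℝ ∙ ξ)ᗮ).real univ)).congr
      fun z hz => ?_⟩
    rw [sectionVolume]
    congr 1
    refine eq_univ_of_forall fun y => ?_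
    have hy : y = 0 := Subsingleton.elim _ _
    refine (hNC _).trans ?_
    rw [hy, ZeroMemClass.coe_zero, zero_add, norm_smul, hξ, mul_one, ← le_inv_mul_iff₀ hC, mul_one]
    exact (abs_lt.2 hz).le
  obtain ⟨δ, hδ, w, hw, hwN⟩ := hN.exists_smooth_slope hξ
  refine ⟨δ, hδ, ?_⟩
  set Ω : Set ((ℝ ∙ ξ)ᗮ × ℝ) := {x | ‖x.1‖ ∈ Ioo (1 / 2 : ℝ) 2 ∧ x.2 ∈ Ioo (-δ) δ}
  have hΩ : IsOpen Ω := (continuous_fst.norm.isOpen_preimage _ isOpen_Ioo).inter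
    (continuous_snd.isOpen_preimage _ isOpen_Ioo)
  have hne : ∀ x ∈ Ω, (x.1 : E) + w x • ξ ≠ 0 := by
    intro x hx h
    have := norm_le_norm_orthogonal_add_smul hξ x.1 (w x)
    rw [h, norm_zero] at this
    linarith [hx.1.1]
  have hNw : ContDiffOn ℝ ∞ (fun x : (ℝ ∙ ξ)ᗮ × ℝ => (N (x.1 + w x • ξ))⁻¹) Ω := by
    refine ContDiffOn.inv ?_ fun x hx => (hN.pos _ (hne x hx)).ne'
    refine hN.contDiffOn.comp (ContDiffOn.add ?_ (hw.smul contDiffOn_const)) hne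
    exact ((ℝ ∙ ξ)ᗮ.subtypeL.contDiff.comp contDiff_fst).contDiffOn
  have hmem : ∀ θ : Metric.sphere (0 : (ℝ ∙ ξ)ᗮ) 1, ∀ z ∈ Ioo (-δ) δ, ((θ : (ℝ ∙ ξ)ᗮ), z) ∈ Ω := by
    intro θ z hz
    refine ⟨?_, hz⟩
    rw [norm_eq_of_mem_sphere]
    norm_num
  refine (contDiffOn_integral_of_contDiffOn
    (σ := (volume : Measure (ℝ ∙ ξ)ᗮ).toSphere) continuous_subtype_val hΩ isOpen_Ioo
    ((hNw.pow (Module.finrank ℝ (ℝ ∙ ξ)ᗮ)).div_const (Module.finrank ℝ (ℝ ∙ ξ)ᗮ : ℝ))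
    hmem).congr fun z hz => ?_
  refine volume_real_eq_integral_radial ?_ (fun θ => ?_) (fun θ r hr => ?_)
    (ρ := fun θ : Metric.sphere (0 : (ℝ ∙ ξ)ᗮ) 1 =>
      (N (((θ : (ℝ ∙ ξ)ᗮ) : E) + w ((θ : (ℝ ∙ ξ)ᗮ), z) • ξ))⁻¹)
  · exact hNw.continuousOn.comp_continuous (f := fun θ : Metric.sphere (0 : (ℝ ∙ ξ)ᗮ) 1 =>
      ((θ : (ℝ ∙ ξ)ᗮ), z)) (by fun_prop) fun θ => hmem θ z hz
  · exact inv_pos.2 (hN.pos _ (hne _ (hmem θ z hz)))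
  · rw [le_inv_comm₀ hr (hN.pos _ (hne _ (hmem θ z hz))), ← mul_one r⁻¹, le_inv_mul_iff₀ hr]
    exact hwN θ (hmem θ z hz).1 z hz r hr

end Section

/-! ### Slicing by parallel hyperplanes -/

section Slicing

variable {E : Type*} [NormedAddCommGroup E] [InnerProductSpace ℝ E] [FiniteDimensional ℝ E]
  [MeasurableSpace E] [BorelSpace E] {ξ : E} {N : E → ℝ}

omit [FiniteDimensional ℝ E] [MeasurableSpace E] [BorelSpace E] in
theorem abs_le_norm_orthogonal_add_smul (hξ : ‖ξ‖ = 1) (v : (ℝ ∙ ξ)ᗮ) (w : ℝ) :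
    |w| ≤ ‖(v : E) + w • ξ‖ := by
  refine abs_le_of_sq_le_sq ?_ (norm_nonneg _)
  nlinarith [norm_sq_orthogonal_add_smul hξ v w, sq_nonneg ‖v‖]

/-- The coordinates `x = y + t ξ` with `y ∈ ξ^⊥` are those of the isometry `E = ℝ ξ ⊕ ξ^⊥`. -/
theorem measurePreserving_orthogonal_add_smul (hξ : ‖ξ‖ = 1) :
    MeasurePreserving (fun p : ℝ × (ℝ ∙ ξ)ᗮ => (p.2 : E) + p.1 • ξ) := by
  have h1 : MeasurePreserving
      (Prod.map (LinearIsometryEquiv.toSpanUnitSingleton (𝕜 := ℝ) ξ hξ)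
        (id : (ℝ ∙ ξ)ᗮ → (ℝ ∙ ξ)ᗮ)) :=
    MeasurePreserving.prod (LinearIsometryEquiv.toSpanUnitSingleton ξ hξ).measurePreserving
      (MeasurePreserving.id volume)
  have h2 := (ℝ ∙ ξ).orthogonalDecomposition.symm.measurePreserving.comp
    ((WithLp.volume_preserving_toLp (ℝ ∙ ξ) (ℝ ∙ ξ)ᗮ).comp h1)
  convert h2 using 1
  ext p
  simp [LinearIsometryEquiv.toSpanUnitSingleton_apply, add_comm]

theorem measurableEmbedding_orthogonal_add_smul (hξ : ‖ξ‖ = 1) :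
    MeasurableEmbedding (fun p : ℝ × (ℝ ∙ ξ)ᗮ => (p.2 : E) + p.1 • ξ) := by
  refine Measurable.measurableEmbedding (by fun_prop) ?_
  rintro ⟨t, y⟩ ⟨t', y'⟩ h
  have h0 : ((y - y' : (ℝ ∙ ξ)ᗮ) : E) + (t - t') • ξ = 0 := by
    have h' : (y : E) + t • ξ = y' + t' • ξ := h
    rw [Submodule.coe_sub, sub_smul, ← sub_eq_zero.2 h']
    abel
  have h1 := norm_sq_orthogonal_add_smul hξ (y - y') (t - t')
  rw [h0, norm_zero] at h1
  have h2 : ‖y - y'‖ = 0 := by nlinarith [norm_nonneg (y - y'), sq_nonneg (t - t')]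
  have h3 : t - t' = 0 := by nlinarith [norm_nonneg (y - y'), sq_nonneg (t - t')]
  rw [norm_eq_zero] at h2
  rw [sub_eq_zero.1 h2, sub_eq_zero.1 h3]

theorem integral_eq_integral_slices {F : Type*} [NormedAddCommGroup F] [NormedSpace ℝ F]
    (hξ : ‖ξ‖ = 1) {f : E → F} (hf : Integrable f) :
    ∫ x, f x = ∫ t : ℝ, ∫ y : (ℝ ∙ ξ)ᗮ, f (y + t • ξ) := by
  have h := measurePreserving_orthogonal_add_smul hξ
  rw [← h.integral_comp (measurableEmbedding_orthogonal_add_smul hξ)]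
  exact integral_prod _ (h.integrable_comp_of_integrable hf)

namespace IsSmoothGauge

theorem measurable_sectionVolume (hN : IsSmoothGauge N) (ξ : E) :
    Measurable (sectionVolume N ξ) := by
  have hm : MeasurableSet {p : ℝ × (ℝ ∙ ξ)ᗮ | N ((p.2 : E) + p.1 • ξ) ≤ 1} :=
    (isClosed_le (hN.continuous.comp (by fun_prop)) continuous_const).measurableSet
  exact (measurable_measure_prodMk_left (ν := volume) hm).ennreal_toReal

omit [MeasurableSpace E] [BorelSpace E] in
theorem isCompact_section (hN : IsSmoothGauge N) (hξ : ‖ξ‖ = 1) (s t : ℝ) :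
    IsCompact {y : (ℝ ∙ ξ)ᗮ | N (y + t • ξ) ≤ s} := by
  obtain ⟨c, hc, hle⟩ := hN.exists_norm_le
  refine (isCompact_closedBall (0 : (ℝ ∙ ξ)ᗮ) (s / c)).of_isClosed_subset
    (isClosed_le (hN.continuous.comp (by fun_prop)) continuous_const) fun y hy => ?_
  rw [mem_closedBall_zero_iff, le_div_iff₀ hc, mul_comm]
  exact (mul_le_mul_of_nonneg_left (norm_le_norm_orthogonal_add_smul hξ y t) hc.le).trans
    ((hle _).trans hy)

theorem sectionVolume_nonneg (z : ℝ) : 0 ≤ sectionVolume N ξ z := measureReal_nonneg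

theorem exists_sectionVolume_le (hN : IsSmoothGauge N) (hξ : ‖ξ‖ = 1) :
    ∃ B, ∀ z, sectionVolume N ξ z ≤ B := by
  obtain ⟨c, hc, hle⟩ := hN.exists_norm_le
  refine ⟨volume.real (Metric.closedBall (0 : (ℝ ∙ ξ)ᗮ) c⁻¹), fun z => ?_⟩
  refine measureReal_mono (fun y hy => ?_) measure_closedBall_lt_top.ne
  rw [mem_closedBall_zero_iff, ← mul_one c⁻¹, le_inv_mul_iff₀ hc]
  exact (mul_le_mul_of_nonneg_left (norm_le_norm_orthogonal_add_smul hξ y z) hc.le).trans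
    ((hle _).trans hy)

theorem exists_sectionVolume_eq_zero (hN : IsSmoothGauge N) (hξ : ‖ξ‖ = 1) :
    ∃ R > 0, ∀ z, R < |z| → sectionVolume N ξ z = 0 := by
  obtain ⟨c, hc, hle⟩ := hN.exists_norm_le
  refine ⟨c⁻¹, by positivity, fun z hz => ?_⟩
  have : {y : (ℝ ∙ ξ)ᗮ | N (y + z • ξ) ≤ 1} = ∅ := by
    refine eq_empty_of_forall_notMem fun y hy => hz.not_ge ?_
    rw [← mul_one c⁻¹, le_inv_mul_iff₀ hc]
    exact (mul_le_mul_of_nonneg_left (abs_le_norm_orthogonal_add_smul hξ y z) hc.le).trans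
      ((hle _).trans hy)
  rw [sectionVolume, this, measureReal_empty]

open scoped Pointwise in
/-- The section at height `t` of the dilated body `{N ≤ s}`. -/
theorem volume_section_eq (hN : IsSmoothGauge N) {s : ℝ} (hs : 0 < s) (t : ℝ) :
    (volume : Measure (ℝ ∙ ξ)ᗮ).real {y | N (y + t • ξ) ≤ s} =
      s ^ Module.finrank ℝ (ℝ ∙ ξ)ᗮ * sectionVolume N ξ (t / s) := by
  have : {y : (ℝ ∙ ξ)ᗮ | N (y + t • ξ) ≤ s} = s • {y : (ℝ ∙ ξ)ᗮ | N (y + (t / s) • ξ) ≤ 1} := by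
    ext y
    rw [mem_smul_set_iff_inv_smul_mem₀ hs.ne', mem_ofPred_eq, mem_ofPred_eq]
    have h1 : (y : E) + t • ξ = s • (((s⁻¹ • y : (ℝ ∙ ξ)ᗮ) : E) + (t / s) • ξ) := by
      rw [smul_add, Submodule.coe_smul, smul_smul, smul_smul, mul_inv_cancel₀ hs.ne', one_smul,
        mul_div_cancel₀ _ hs.ne']
    rw [h1, hN.smul s hs.le, ← le_inv_mul_iff₀ hs, inv_mul_cancel₀ hs.ne']
  rw [this, Measure.real, Measure.addHaar_smul, ENNReal.toReal_mul,
    ENNReal.toReal_ofReal (abs_nonneg _), abs_of_pos (by positivity)]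
  rfl

end IsSmoothGauge

/-- The integrals of the radial profile `η ∘ N` over the hyperplanes orthogonal to `ξ`. -/
noncomputable def sectionIntegral (N : E → ℝ) (η : ℝ → ℝ) (ξ : E) (t : ℝ) : ℝ :=
  ∫ y : (ℝ ∙ ξ)ᗮ, η (N (y + t • ξ))

namespace IsSmoothGauge

variable {η : ℝ → ℝ}

theorem sectionIntegral_neg (hN : IsSmoothGauge N) (t : ℝ) :
    sectionIntegral N η ξ (-t) = sectionIntegral N η ξ t := by
  rw [sectionIntegral, ← integral_neg_eq_self]
  refine integral_congr_ae (Eventually.of_forall fun y => ?_)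
  simp only [Submodule.coe_neg, neg_smul]
  rw [← neg_add, hN.neg]

/-- Layer-cake formula: `η ∘ N` is a superposition of indicators of the dilates of `{N ≤ 1}`. -/
theorem sectionIntegral_eq (hN : IsSmoothGauge N) (hξ : ‖ξ‖ = 1) (hη : ContDiff ℝ ∞ η)
    (hηc : HasCompactSupport η) (t : ℝ) :
    sectionIntegral N η ξ t = -∫ s in Ioi (0 : ℝ),
      deriv η s * (s ^ Module.finrank ℝ (ℝ ∙ ξ)ᗮ * sectionVolume N ξ (t / s)) := by
  have hη' : Continuous (deriv η) := hη.continuous_deriv (by simp)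
  have hηc' : HasCompactSupport (deriv η) := hηc.deriv
  have hηi : Integrable (deriv η) := hη'.integrable_of_hasCompactSupport hηc'
  set f : (ℝ ∙ ξ)ᗮ → ℝ → ℝ := fun y s =>
    {p : (ℝ ∙ ξ)ᗮ × ℝ | N (p.1 + t • ξ) ≤ p.2}.indicator (fun p => deriv η p.2) (y, s) with hf
  have hclosed : IsClosed {p : (ℝ ∙ ξ)ᗮ × ℝ | N (p.1 + t • ξ) ≤ p.2} :=
    isClosed_le (hN.continuous.comp (by fun_prop)) continuous_snd
  have hinner : ∀ y, ∫ s in Ioi (0 : ℝ), f y s = -η (N (y + t • ξ)) := by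
    intro y
    have h1 : (fun s => f y s) = (Ici (N (y + t • ξ))).indicator (deriv η) := rfl
    have h2 : ∫ s in Ioi (0 : ℝ), f y s = ∫ s in Ici (N (y + t • ξ)), deriv η s := by
      rw [h1, ← integral_Ici_eq_integral_Ioi, setIntegral_indicator measurableSet_Ici,
        Ici_inter_Ici, sup_eq_right.2 (hN.nonneg _)]
    rw [h2, integral_Ici_eq_integral_Ioi]
    have h3 : Tendsto η atTop (𝓝 0) := by
      obtain ⟨R, hR⟩ := hηc.isCompact.bddAbove
      refine tendsto_const_nhds.congr' ?_
      filter_upwards [eventually_gt_atTop R] with s hs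
      by_contra h
      exact hs.not_ge (hR (subset_tsupport _ (Ne.symm h)))
    rw [integral_Ioi_of_hasDerivAt_of_tendsto' (fun s _ =>
      ((hη.differentiable (by simp)) s).hasDerivAt) hηi.integrableOn h3, zero_sub]
  have hprod : Integrable (Function.uncurry f)
      ((volume : Measure (ℝ ∙ ξ)ᗮ).prod (volume.restrict (Ioi (0 : ℝ)))) := by
    obtain ⟨R, hR⟩ := hηc'.isCompact.bddAbove
    have hK := hN.isCompact_section hξ R t
    have h1 : Integrable (fun p : (ℝ ∙ ξ)ᗮ × ℝ =>
        {y : (ℝ ∙ ξ)ᗮ | N (y + t • ξ) ≤ R}.indicator (fun _ => (1 : ℝ)) p.1 * deriv η p.2)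
        ((volume : Measure (ℝ ∙ ξ)ᗮ).prod (volume.restrict (Ioi (0 : ℝ)))) :=
      Integrable.mul_prod ((integrable_indicator_iff hK.measurableSet).2
        (integrableOn_const hK.measure_lt_top.ne)) hηi.integrableOn
    refine h1.mono ?_ (Eventually.of_forall fun p => ?_)
    · exact ((hη'.comp continuous_snd).measurable.indicator
        hclosed.measurableSet).aestronglyMeasurable
    · by_cases hp : N (p.1 + t • ξ) ≤ p.2
      · by_cases hp2 : deriv η p.2 = 0
        · simp [Function.uncurry, hf, indicator_apply, hp2]
        · have hpR : N (p.1 + t • ξ) ≤ R := hp.trans (hR (subset_tsupport _ hp2))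
          simp [Function.uncurry, hf, hp, hpR]
      · simp only [Function.uncurry, hf, indicator_apply, mem_ofPred_eq, hp, if_false, norm_zero]
        positivity
  have hinner' : ∀ s ∈ Ioi (0 : ℝ), ∫ y, f y s =
      deriv η s * (s ^ Module.finrank ℝ (ℝ ∙ ξ)ᗮ * sectionVolume N ξ (t / s)) := by
    intro s hs
    have hm : MeasurableSet {y : (ℝ ∙ ξ)ᗮ | N (y + t • ξ) ≤ s} :=
      (hN.isCompact_section hξ s t).measurableSet
    have h1 : (fun y => f y s) =
      {y : (ℝ ∙ ξ)ᗮ | N (y + t • ξ) ≤ s}.indicator fun _ => deriv η s := rfl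
    rw [h1, integral_indicator_const _ hm, hN.volume_section_eq hs, smul_eq_mul, mul_comm]
  rw [← setIntegral_congr_fun measurableSet_Ioi hinner', ← integral_integral_swap hprod]
  simp only [hinner, integral_neg, neg_neg]
  rfl

end IsSmoothGauge

end Slicing

/-! ### Mellin transforms -/

section Mellin

theorem isBigO_atTop_of_eq_zero {f : ℝ → ℂ} {R : ℝ} (hR : ∀ t, R < t → f t = 0) (g : ℝ → ℝ) :
    f =O[atTop] g := by
  have : f =ᶠ[atTop] fun _ => 0 := by
    filter_upwards [eventually_gt_atTop R] with t ht using hR t ht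
  exact this.trans_isBigO (Asymptotics.isBigO_zero _ _)

theorem locallyIntegrable_of_bounded {f : ℝ → ℂ} (hf : Measurable f) {B : ℝ}
    (hB : ∀ t, ‖f t‖ ≤ B) : LocallyIntegrable f :=
  (locallyIntegrable_const B).mono hf.aestronglyMeasurable
    (Eventually.of_forall fun t => (hB t).trans (le_abs_self B))

theorem mellinConvergent_of_bounded {f : ℝ → ℂ} (hf : Measurable f) {B R : ℝ}
    (hB : ∀ t, ‖f t‖ ≤ B) (hR : ∀ t, R < t → f t = 0) {s : ℂ} (hs : 0 < s.re) :
    MellinConvergent f s := by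
  refine mellinConvergent_of_isBigO_rpow ((locallyIntegrable_of_bounded hf hB).locallyIntegrableOn _)
    (isBigO_atTop_of_eq_zero hR _) (lt_add_one s.re) ?_ hs
  refine Asymptotics.IsBigO.of_bound B (Eventually.of_forall fun t => ?_)
  simpa using hB t

variable {f : ℝ → ℂ}

theorem exists_pos_of_tsupport_subset (hc : HasCompactSupport f) (hs : tsupport f ⊆ Ioi 0) :
    ∃ ε > 0, ∀ t < ε, f t = 0 := by
  rcases (tsupport f).eq_empty_or_nonempty with he | hne
  · refine ⟨1, one_pos, fun t _ => ?_⟩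
    rw [tsupport_eq_empty_iff.1 he]
    rfl
  · obtain ⟨ε, hε, hmin⟩ := hc.isCompact.exists_isLeast hne
    refine ⟨ε, hs hε, fun t ht => ?_⟩
    by_contra h
    exact ht.not_ge (hmin (subset_tsupport f h))

theorem exists_eq_zero_of_hasCompactSupport (hc : HasCompactSupport f) :
    ∃ R : ℝ, ∀ t, R < t → f t = 0 := by
  obtain ⟨R, hR⟩ := hc.isCompact.bddAbove
  refine ⟨R, fun t ht => ?_⟩
  by_contra h
  exact ht.not_ge (hR (subset_tsupport f h))

theorem isBigO_nhdsGT_of_tsupport_subset (hc : HasCompactSupport f) (hs : tsupport f ⊆ Ioi 0)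
    (g : ℝ → ℝ) : f =O[𝓝[>] 0] g := by
  obtain ⟨ε, hε, h⟩ := exists_pos_of_tsupport_subset hc hs
  have : f =ᶠ[𝓝[>] 0] fun _ => 0 := by
    filter_upwards [mem_nhdsWithin_of_mem_nhds (Iio_mem_nhds hε)] with t ht using h t ht
  exact this.trans_isBigO (Asymptotics.isBigO_zero _ _)

theorem mellinConvergent_of_tsupport_subset (hf : Continuous f) (hc : HasCompactSupport f)
    (hs : tsupport f ⊆ Ioi 0) (s : ℂ) : MellinConvergent f s := by
  obtain ⟨R, hR⟩ := exists_eq_zero_of_hasCompactSupport hc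
  exact mellinConvergent_of_isBigO_rpow (hf.locallyIntegrable.locallyIntegrableOn _)
    (isBigO_atTop_of_eq_zero hR _) (lt_add_one s.re)
    (isBigO_nhdsGT_of_tsupport_subset hc hs _) (sub_one_lt s.re)

theorem differentiable_mellin_of_tsupport_subset (hf : Continuous f) (hc : HasCompactSupport f)
    (hs : tsupport f ⊆ Ioi 0) : Differentiable ℂ (mellin f) := by
  obtain ⟨R, hR⟩ := exists_eq_zero_of_hasCompactSupport hc
  exact fun s => mellin_differentiableAt_of_isBigO_rpow (hf.locallyIntegrable.locallyIntegrableOn _)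
    (isBigO_atTop_of_eq_zero hR _) (lt_add_one s.re)
    (isBigO_nhdsGT_of_tsupport_subset hc hs _) (sub_one_lt s.re)

/-- Integration by parts in the Mellin transform. -/
theorem mellin_deriv_add_one {f' : ℝ → ℂ} (hf : ∀ t, HasDerivAt f (f' t) t)
    (hf' : Continuous f') (hc : HasCompactSupport f) (hs : tsupport f ⊆ Ioi 0) (s : ℂ) :
    mellin f' (s + 1) = -(s * mellin f s) := by
  have hd : f' = deriv f := funext fun t => (hf t).deriv.symm
  have hc' : HasCompactSupport f' := hd ▸ hc.deriv
  have hs' : tsupport f' ⊆ Ioi 0 := (hd ▸ closure_minimal (support_deriv_subset)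
    (isClosed_tsupport f)).trans hs
  have hcont : Continuous f := continuous_iff_continuousAt.2 fun t => (hf t).continuousAt
  have h1 := mellinConvergent_of_tsupport_subset hf' hc' hs' (s + 1)
  have h2 := mellinConvergent_of_tsupport_subset hcont hc hs s
  have hderiv : ∀ t ∈ Ioi (0 : ℝ), HasDerivAt (fun t : ℝ => (t : ℂ) ^ s * f t)
      (s * ((t : ℂ) ^ (s - 1) • f t) + (t : ℂ) ^ (s + 1 - 1) • f' t) t := by
    intro t ht
    have h3 : HasDerivAt (fun t : ℝ => (t : ℂ) ^ s) (s * (t : ℂ) ^ (s - 1) * 1) t :=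
      ((hasDerivAt_id (t : ℂ)).cpow_const (Complex.ofReal_mem_slitPlane.2 ht)).comp_ofReal
    refine (h3.mul (hf t)).congr_deriv ?_
    rw [smul_eq_mul, smul_eq_mul, add_sub_cancel_right]
    ring
  obtain ⟨ε, hε, hf0⟩ := exists_pos_of_tsupport_subset hc hs
  obtain ⟨R, hR⟩ := exists_eq_zero_of_hasCompactSupport hc
  have hlim : Tendsto (fun t : ℝ => (t : ℂ) ^ s * f t) atTop (𝓝 0) := by
    refine tendsto_const_nhds.congr' ?_
    filter_upwards [eventually_gt_atTop R] with t ht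
    rw [hR t ht, mul_zero]
  have hcw : ContinuousWithinAt (fun t : ℝ => (t : ℂ) ^ s * f t) (Ici 0) 0 := by
    refine (continuousAt_const (y := (0 : ℂ))).congr ?_ |>.continuousWithinAt
    filter_upwards [Iio_mem_nhds hε] with t ht
    rw [hf0 t ht, mul_zero]
  have h4 := integral_Ioi_of_hasDerivAt_of_tendsto hcw hderiv ((h2.const_mul s).add h1) hlim
  rw [integral_add (h2.const_mul s) h1, integral_const_mul, hf0 0 hε, mul_zero, sub_zero] at h4
  exact eq_neg_of_add_eq_zero_right h4

/-- The Mellin transform of a superposition of dilates `t ↦ g (t / s)`. -/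
theorem mellin_superposition {g w : ℝ → ℝ} (hg : Measurable g) {B R : ℝ} (hB : ∀ t, |g t| ≤ B)
    (hR : ∀ t, R < t → g t = 0) (hR0 : 0 ≤ R) (hw : Continuous w) (hwc : HasCompactSupport w)
    {a : ℂ} (ha : 0 < a.re) :
    mellin (fun t => ((∫ s in Ioi (0 : ℝ), w s * g (t / s) : ℝ) : ℂ)) a =
      mellin (fun s => (w s : ℂ)) (a + 1) * mellin (fun t => (g t : ℂ)) a := by
  obtain ⟨R', hR'⟩ := hwc.isCompact.bddAbove
  have hwR' : ∀ s, R' < s → w s = 0 := fun s hs => by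
    by_contra h
    exact hs.not_ge (hR' (subset_tsupport _ h))
  have hprod : Integrable (Function.uncurry fun t s : ℝ =>
      (t : ℂ) ^ (a - 1) * ((w s * g (t / s) : ℝ) : ℂ))
      ((volume.restrict (Ioi (0 : ℝ))).prod (volume.restrict (Ioi (0 : ℝ)))) := by
    have h1 : IntegrableOn (fun t : ℝ => (t : ℂ) ^ (a - 1) • ((Iic (R * R')).indicator
        (fun _ => (B : ℂ)) t)) (Ioi 0) := by
      refine mellinConvergent_of_bounded (B := |B|) (R := R * R')
        (measurable_const.indicator measurableSet_Iic) (fun t => ?_) (fun t ht => ?_) ha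
      · refine (norm_indicator_le_norm_self _ _).trans ?_
        simp
      · simp [ht]
    have h2 : IntegrableOn w (Ioi 0) :=
      (hw.integrable_of_hasCompactSupport hwc).integrableOn
    refine (h1.mul_prod h2.ofReal).mono ?_ ?_
    · refine Measurable.aestronglyMeasurable ?_
      have : Measurable fun p : ℝ × ℝ => w p.2 * g (p.1 / p.2) :=
        (hw.measurable.comp measurable_snd).mul (hg.comp (measurable_fst.div measurable_snd))
      exact (by fun_prop : Measurable fun p : ℝ × ℝ => (p.1 : ℂ) ^ (a - 1)).mul
        (Complex.measurable_ofReal.comp this)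
    · rw [Measure.prod_restrict]
      filter_upwards [ae_restrict_mem (measurableSet_Ioi.prod measurableSet_Ioi)] with p hp
      obtain ⟨hp1, hp2⟩ : 0 < p.1 ∧ 0 < p.2 := hp
      simp only [Function.uncurry, smul_eq_mul, norm_mul, mul_assoc]
      refine mul_le_mul_of_nonneg_left ?_ (norm_nonneg _)
      by_cases h : p.1 ≤ R * R'
      · rw [indicator_of_mem (show p.1 ∈ Iic (R * R') from h), mul_comm]
        simp only [Complex.norm_real, Complex.ofReal_mul, norm_mul, Real.norm_eq_abs]
        exact mul_le_mul ((hB _).trans (le_abs_self B)) (by simp) (abs_nonneg _) (abs_nonneg B)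
      · have : w p.2 * g (p.1 / p.2) = 0 := by
          by_cases hw2 : R' < p.2
          · rw [hwR' _ hw2, zero_mul]
          · rw [hR, mul_zero]
            rw [lt_div_iff₀ hp2]
            nlinarith
        rw [this]
        simp only [Complex.ofReal_zero, norm_zero]
        positivity
  have h3 : mellin (fun t => ((∫ s in Ioi (0 : ℝ), w s * g (t / s) : ℝ) : ℂ)) a =
      ∫ t in Ioi (0 : ℝ), ∫ s in Ioi (0 : ℝ), (t : ℂ) ^ (a - 1) * ((w s * g (t / s) : ℝ) : ℂ) := by
    refine setIntegral_congr_fun measurableSet_Ioi fun t _ => ?_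
    simp only [smul_eq_mul]
    rw [integral_const_mul, integral_complex_ofReal]
  rw [h3, integral_integral_swap hprod, mellin, ← integral_mul_const]
  refine setIntegral_congr_fun measurableSet_Ioi fun s hs => ?_
  have hs : 0 < s := hs
  have h4 := mellin_comp_mul_right (fun t => (g t : ℂ)) a (inv_pos.2 hs)
  have h5 : ∫ t in Ioi (0 : ℝ), (t : ℂ) ^ (a - 1) * ((w s * g (t / s) : ℝ) : ℂ) =
      w s * mellin (fun t => (g (t * s⁻¹) : ℂ)) a := by
    rw [mellin, ← integral_const_mul]
    refine setIntegral_congr_fun measurableSet_Ioi fun t _ => ?_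
    simp only [Complex.ofReal_mul, smul_eq_mul, div_eq_mul_inv]
    ring
  simp only [h5]
  rw [h4, smul_eq_mul, add_sub_cancel_right, smul_eq_mul, Complex.ofReal_inv, Complex.inv_cpow,
    Complex.cpow_neg, inv_inv]
  · ring
  · rw [Complex.arg_ofReal_of_nonneg hs.le]
    exact Real.pi_pos.ne

end Mellin

/-! ### The Mellin transform of a cosine transform -/

section CosineTransform

theorem integral_eq_integral_Ioi_add_neg {f : ℝ → ℂ} (hf : Integrable f) :
    ∫ t, f t = ∫ t in Ioi (0 : ℝ), (f t + f (-t)) := by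
  rw [integral_add hf.integrableOn hf.comp_neg.integrableOn, integral_comp_neg_Ioi, neg_zero,
    add_comm, intervalIntegral.integral_Iic_add_Ioi hf.integrableOn hf.integrableOn]

/-- The regularized moment `Γ(b)⁻¹ ∫ u^(b-1) e^(-ε u) e^(-i u t) du`, in closed form, is bounded
uniformly in `ε`. -/
theorem norm_inv_add_mul_I_cpow_le {b : ℂ} (hb : 0 < b.re) (ε : ℝ) {t : ℝ} (ht : t ≠ 0) :
    ‖(1 / ((ε : ℂ) + t * Complex.I)) ^ b‖ ≤ Real.exp (Real.pi * |b.im|) * |t| ^ (-b.re) := by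
  have h0 : (1 / ((ε : ℂ) + t * Complex.I)) ≠ 0 := by
    refine one_div_ne_zero fun h => ht ?_
    simpa using congrArg Complex.im h
  rw [Complex.norm_cpow_of_ne_zero h0, div_eq_inv_mul, ← Real.exp_neg]
  refine mul_le_mul (Real.exp_le_exp.2 ?_) ?_ (by positivity) (by positivity)
  · rw [← neg_mul]
    refine (le_abs_self _).trans ?_
    rw [abs_mul, abs_neg]
    exact mul_le_mul_of_nonneg_right (Complex.abs_arg_le_pi _) (abs_nonneg _)
  · rw [Real.rpow_neg (abs_nonneg t), ← Real.inv_rpow (abs_nonneg t)]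
    refine Real.rpow_le_rpow (norm_nonneg _) ?_ hb.le
    rw [norm_div, norm_one, one_div]
    refine inv_anti₀ (abs_pos.2 ht) ?_
    simpa using Complex.abs_im_le_norm ((ε : ℂ) + t * Complex.I)

/-- The phases `e^(∓iπb/2)` of the two half-lines add up to a cosine. -/
theorem one_div_mul_I_cpow_add {t : ℝ} (ht : 0 < t) (b : ℂ) :
    (1 / ((t : ℂ) * Complex.I)) ^ b + (1 / ((-t : ℝ) * Complex.I)) ^ b =
      2 * Complex.cos (b * Real.pi / 2) * (t : ℂ) ^ (-b) := by
  have h1 : 1 / ((t : ℂ) * Complex.I) = ((t⁻¹ : ℝ) : ℂ) * -Complex.I := by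
    rw [one_div, mul_inv, Complex.inv_I]
    simp
  have h2 : 1 / (((-t : ℝ) : ℂ) * Complex.I) = ((t⁻¹ : ℝ) : ℂ) * Complex.I := by
    rw [one_div, mul_inv, Complex.inv_I]
    simp [inv_neg]
  have h3 : ((t⁻¹ : ℝ) : ℂ) ^ b = (t : ℂ) ^ (-b) := by
    rw [Complex.ofReal_inv, Complex.inv_cpow, Complex.cpow_neg]
    rw [Complex.arg_ofReal_of_nonneg ht.le]
    exact Real.pi_pos.ne
  have hI : Complex.log (-Complex.I) = -(Real.pi / 2) * Complex.I := by
    rw [Complex.log_neg_I]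
  have ht' : ((t⁻¹ : ℝ) : ℂ) ≠ 0 := Complex.ofReal_ne_zero.2 (inv_ne_zero ht.ne')
  have hmul : ∀ x : ℂ, x ≠ 0 → ((t⁻¹ : ℝ) * x) ^ b = (t : ℂ) ^ (-b) * x ^ b := by
    intro x hx
    rw [← h3, Complex.cpow_def_of_ne_zero (mul_ne_zero ht' hx), Complex.cpow_def_of_ne_zero ht',
      Complex.cpow_def_of_ne_zero hx, Complex.log_ofReal_mul (inv_pos.2 ht) hx,
      Complex.ofReal_log (inv_pos.2 ht).le, add_mul, Complex.exp_add]
  rw [h1, h2, hmul _ (neg_ne_zero.2 Complex.I_ne_zero), hmul _ Complex.I_ne_zero,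
    Complex.cpow_def_of_ne_zero (neg_ne_zero.2 Complex.I_ne_zero),
    Complex.cpow_def_of_ne_zero Complex.I_ne_zero, hI, Complex.log_I, Complex.cos]
  have e1 : -(Real.pi / 2 : ℂ) * Complex.I * b = -(b * Real.pi / 2) * Complex.I := by ring
  have e2 : (Real.pi / 2 : ℂ) * Complex.I * b = b * Real.pi / 2 * Complex.I := by ring
  rw [e1, e2]
  ring

theorem integrableOn_cpow_mul_cexp_neg_mul {b r : ℂ} (hb : 0 < b.re) (hr : 0 < r.re) :
    IntegrableOn (fun t : ℝ => (t : ℂ) ^ (b - 1) * Complex.exp (-(r * t))) (Ioi 0) := by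
  have h1 : IntegrableOn (fun t : ℝ => t ^ (b.re - 1) * Real.exp (-r.re * t ^ (1 : ℝ))) (Ioi 0) :=
    integrableOn_rpow_mul_exp_neg_mul_rpow (by linarith) one_pos hr
  refine Integrable.mono h1 (Measurable.aestronglyMeasurable (by fun_prop)) ?_
  filter_upwards [ae_restrict_mem measurableSet_Ioi] with t ht
  have ht : 0 < t := ht
  rw [norm_mul, norm_mul, Complex.norm_cpow_eq_rpow_re_of_pos ht, Complex.norm_exp,
    Real.norm_of_nonneg (Real.rpow_nonneg ht.le _), Real.norm_of_nonneg (Real.exp_nonneg _)]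
  simp

theorem differentiableAt_integral_cpow_mul_cexp_neg_mul {b r : ℂ} (hb : 0 < b.re) (hr : 0 < r.re) :
    DifferentiableAt ℂ
      (fun r : ℂ => ∫ t in Ioi (0 : ℝ), (t : ℂ) ^ (b - 1) * Complex.exp (-(r * t))) r := by
  have hs : {z : ℂ | r.re / 2 < z.re} ∈ 𝓝 r :=
    (isOpen_lt continuous_const Complex.continuous_re).mem_nhds (by simpa using hr)
  have hb1 : 0 < (b + 1).re := by simp only [Complex.add_re, Complex.one_re]; linarith
  have hr2 : 0 < ((r.re / 2 : ℝ) : ℂ).re := by simpa using hr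
  refine (hasDerivAt_integral_of_dominated_loc_of_deriv_le (μ := volume.restrict (Ioi (0 : ℝ)))
    (F := fun r (t : ℝ) => (t : ℂ) ^ (b - 1) * Complex.exp (-(r * t)))
    (F' := fun r (t : ℝ) => (t : ℂ) ^ (b - 1) * (Complex.exp (-(r * t)) * (-t)))
    (bound := fun t : ℝ => ‖(t : ℂ) ^ (b + 1 - 1) *
      Complex.exp (-(((r.re / 2 : ℝ) : ℂ) * t))‖) hs ?_ ?_ ?_ ?_ ?_ ?_).2.differentiableAt
  · exact Eventually.of_forall fun z => by fun_prop
  · exact integrableOn_cpow_mul_cexp_neg_mul hb hr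
  · fun_prop
  · filter_upwards [ae_restrict_mem measurableSet_Ioi] with t ht z hz
    have ht : 0 < t := ht
    have hz : r.re / 2 < z.re := hz
    have h1 : (t : ℂ) ^ (b + 1 - 1) = (t : ℂ) ^ (b - 1) * t := by
      rw [show b + 1 - 1 = b - 1 + 1 by ring,
        Complex.cpow_add _ _ (Complex.ofReal_ne_zero.2 ht.ne'), Complex.cpow_one]
    rw [h1, mul_comm (Complex.exp (-(z * t))), mul_assoc, norm_mul, norm_mul, norm_mul, norm_mul,
      norm_neg]
    gcongr
    rw [Complex.norm_exp, Complex.norm_exp, Real.exp_le_exp, Complex.neg_re, Complex.neg_re,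
      Complex.re_mul_ofReal, Complex.re_mul_ofReal, Complex.ofReal_re, neg_le_neg_iff]
    gcongr
  · exact (integrableOn_cpow_mul_cexp_neg_mul hb1 hr2).norm
  · refine Eventually.of_forall fun t z _ => ?_
    have h1 : HasDerivAt (fun z : ℂ => -(z * t)) (-t : ℂ) z := by
      exact ((hasDerivAt_id z).mul_const (t : ℂ)).neg.congr_deriv (by simp)
    exact h1.cexp.const_mul _

/-- The Laplace transform of a power at a complex argument, by analytic continuation from the
positive reals. -/
theorem integral_cpow_mul_cexp_neg_mul_Ioi {b r : ℂ} (hb : 0 < b.re) (hr : 0 < r.re) :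
    ∫ t in Ioi (0 : ℝ), (t : ℂ) ^ (b - 1) * Complex.exp (-(r * t)) =
      (1 / r) ^ b * Complex.Gamma b := by
  have hopen : IsOpen {z : ℂ | 0 < z.re} := isOpen_lt continuous_const Complex.continuous_re
  have hconv : IsPreconnected {z : ℂ | 0 < z.re} := (convex_halfSpace_re_gt 0).isPreconnected
  have h1 : AnalyticOnNhd ℂ
      (fun r : ℂ => ∫ t in Ioi (0 : ℝ), (t : ℂ) ^ (b - 1) * Complex.exp (-(r * t)))
      {z : ℂ | 0 < z.re} :=
    DifferentiableOn.analyticOnNhd (fun z hz =>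
      (differentiableAt_integral_cpow_mul_cexp_neg_mul hb hz).differentiableWithinAt) hopen
  have h2 : AnalyticOnNhd ℂ (fun r : ℂ => (1 / r) ^ b * Complex.Gamma b) {z : ℂ | 0 < z.re} := by
    refine DifferentiableOn.analyticOnNhd (fun z hz => ?_) hopen
    have hz : 0 < z.re := hz
    have hz0 : z ≠ 0 := by rintro rfl; simp at hz
    have hsl : 1 / z ∈ Complex.slitPlane := by
      refine Or.inl ?_
      rw [one_div, Complex.inv_re]
      exact div_pos hz (Complex.normSq_pos.2 hz0)
    refine ((DifferentiableAt.cpow_const ?_ hsl).mul_const _).differentiableWithinAt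
    exact (differentiableAt_const 1).div differentiableAt_id hz0
  refine h1.eqOn_of_preconnected_of_frequently_eq h2 hconv
    (show (1 : ℂ) ∈ {z : ℂ | 0 < z.re} by simp) ?_ hr
  have htend : Tendsto (fun x : ℝ => (x : ℂ)) (𝓝[≠] 1) (𝓝[≠] 1) := by
    refine tendsto_nhdsWithin_of_tendsto_nhds_of_eventually_within _ ?_ ?_
    · simpa using (Complex.continuous_ofReal.tendsto 1).mono_left nhdsWithin_le_nhds
    · filter_upwards [self_mem_nhdsWithin] with x hx
      simpa using hx
  refine htend.frequently (Eventually.frequently ?_)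
  filter_upwards [mem_nhdsWithin_of_mem_nhds (Ioi_mem_nhds one_pos)] with x hx
  exact Complex.integral_cpow_mul_exp_neg_mul_Ioi hb hx

/-- The Mellin transform of the Fourier transform of an even function (`|t|^{-b}` and `|u|^{b-1}`
being Fourier transforms of each other up to a factor). -/
theorem mellin_fourier_of_even {H : ℝ → ℝ} (hH : Measurable H) {B R : ℝ} (hB : ∀ t, |H t| ≤ B)
    (hR : ∀ t, R < |t| → H t = 0) (heven : ∀ t, H (-t) = H t) {b : ℂ} (hb0 : 0 < b.re)
    (hb1 : b.re < 1)
    (hconv : MellinConvergent (fun u => ∫ t : ℝ, Complex.exp (-Complex.I * (t * u : ℝ)) * H t) b) :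
    mellin (fun u => ∫ t : ℝ, Complex.exp (-Complex.I * (t * u : ℝ)) * H t) b =
      Complex.Gamma b * (2 * Complex.cos (b * Real.pi / 2)) * mellin (fun t => (H t : ℂ)) (1 - b) := by
  have hHi : Integrable H := by
    have h1 : IntegrableOn H (Icc (-R) R) := by
      refine Measure.integrableOn_of_bounded (M := B) measure_Icc_lt_top.ne
        hH.aestronglyMeasurable (Eventually.of_forall hB)
    refine (integrableOn_iff_integrable_of_support_subset fun t ht => ?_).1 h1
    by_contra h
    exact ht (hR t (by_contra fun h' => h (abs_le.1 (not_lt.1 h'))))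
  set G : ℝ → ℂ := fun u => ∫ t : ℝ, Complex.exp (-Complex.I * (t * u : ℝ)) * H t with hG
  -- the regularized identity
  have hreg : ∀ ε : ℝ, 0 < ε → ∫ u in Ioi (0 : ℝ), (u : ℂ) ^ (b - 1) * Complex.exp (-(ε * u)) * G u =
      Complex.Gamma b * ∫ t in Ioi (0 : ℝ),
        ((1 / ((ε : ℂ) + t * Complex.I)) ^ b + (1 / ((ε : ℂ) + (-t : ℝ) * Complex.I)) ^ b) * H t := by
    intro ε hε
    have hprod : Integrable (Function.uncurry fun u t : ℝ => (u : ℂ) ^ (b - 1) *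
        Complex.exp (-(ε * u)) * (Complex.exp (-Complex.I * (t * u : ℝ)) * H t))
        ((volume.restrict (Ioi (0 : ℝ))).prod volume) := by
      have h1 : IntegrableOn (fun u : ℝ => (u : ℂ) ^ (b - 1) * Complex.exp (-(ε * u))) (Ioi 0) := by
        exact integrableOn_cpow_mul_cexp_neg_mul hb0 (by simpa using hε)
      refine (h1.mul_prod hHi.ofReal).mono ?_ (Eventually.of_forall fun p => ?_)
      · refine Measurable.aestronglyMeasurable ?_
        fun_prop
      · simp only [Function.uncurry, norm_mul]
        have : ‖Complex.exp (-Complex.I * (p.2 * p.1 : ℝ))‖ = 1 := by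
          rw [Complex.norm_exp]
          simp
        rw [this, one_mul]
        exact le_of_eq rfl
    have h2 : ∀ t : ℝ, t ≠ 0 → ∫ u in Ioi (0 : ℝ), (u : ℂ) ^ (b - 1) *
        Complex.exp (-(ε * u)) * (Complex.exp (-Complex.I * (t * u : ℝ)) * H t) =
        Complex.Gamma b * ((1 / ((ε : ℂ) + t * Complex.I)) ^ b * H t) := by
      intro t ht
      have h3 := integral_cpow_mul_cexp_neg_mul_Ioi (b := b) (r := (ε : ℂ) + t * Complex.I)
        hb0 (by simpa using hε)
      rw [← mul_assoc, mul_comm (Complex.Gamma b), ← h3, ← integral_mul_const]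
      refine setIntegral_congr_fun measurableSet_Ioi fun u _ => ?_
      rw [← mul_assoc, mul_assoc (_ ^ _), ← Complex.exp_add]
      congr 3
      push_cast
      ring
    have h6 : (fun t : ℝ => ∫ u in Ioi (0 : ℝ), (u : ℂ) ^ (b - 1) *
        Complex.exp (-(ε * u)) * (Complex.exp (-Complex.I * (t * u : ℝ)) * H t)) =ᵐ[volume]
        fun t => Complex.Gamma b * ((1 / ((ε : ℂ) + t * Complex.I)) ^ b * H t) := by
      filter_upwards [compl_mem_ae_iff.2 (measure_singleton (0 : ℝ))] with t ht
      exact h2 t ht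
    have h4 : ∫ u in Ioi (0 : ℝ), (u : ℂ) ^ (b - 1) * Complex.exp (-(ε * u)) * G u =
        ∫ t, Complex.Gamma b * ((1 / ((ε : ℂ) + t * Complex.I)) ^ b * H t) := by
      simp only [hG, ← integral_const_mul]
      rw [integral_integral_swap hprod]
      exact integral_congr_ae h6
    rw [h4, integral_eq_integral_Ioi_add_neg (hprod.integral_prod_right.congr h6),
      ← integral_const_mul]
    refine setIntegral_congr_fun measurableSet_Ioi fun t _ => ?_
    simp only [heven]
    ring
  have hlim1 : Tendsto (fun ε : ℝ => ∫ u in Ioi (0 : ℝ),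
      (u : ℂ) ^ (b - 1) * Complex.exp (-(ε * u)) * G u) (𝓝[>] 0) (𝓝 (mellin G b)) := by
    refine tendsto_integral_filter_of_dominated_convergence
      (fun u => ‖(u : ℂ) ^ (b - 1) • G u‖) ?_ ?_ hconv.norm ?_
    · refine Eventually.of_forall fun ε => ?_
      have : Measurable fun u : ℝ => Complex.exp (-(ε * u)) := by fun_prop
      refine (this.aestronglyMeasurable.mul hconv.aestronglyMeasurable).congr
        (Eventually.of_forall fun u => ?_)
      simp only [smul_eq_mul, Pi.mul_apply]
      ring
    · filter_upwards [self_mem_nhdsWithin] with ε hε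
      filter_upwards [ae_restrict_mem measurableSet_Ioi] with u hu
      have hε : 0 < ε := hε
      have hu : 0 < u := hu
      rw [norm_smul, norm_mul, norm_mul]
      refine mul_le_mul_of_nonneg_right ?_ (norm_nonneg _)
      refine mul_le_of_le_one_right (norm_nonneg _) ?_
      rw [Complex.norm_exp, Real.exp_le_one_iff]
      simp only [Complex.neg_re, Complex.mul_re, Complex.ofReal_re, Complex.ofReal_im]
      nlinarith
    · refine Eventually.of_forall fun u => ?_
      have : Continuous fun ε : ℝ => (u : ℂ) ^ (b - 1) * Complex.exp (-(ε * u)) * G u := by fun_prop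
      simpa using (this.tendsto 0).mono_left nhdsWithin_le_nhds
  have hlim2 : Tendsto (fun ε : ℝ => ∫ t in Ioi (0 : ℝ),
        ((1 / ((ε : ℂ) + t * Complex.I)) ^ b + (1 / ((ε : ℂ) + (-t : ℝ) * Complex.I)) ^ b) * H t)
      (𝓝[>] 0) (𝓝 (∫ t in Ioi (0 : ℝ),
        ((1 / ((t : ℂ) * Complex.I)) ^ b + (1 / ((-t : ℝ) * Complex.I)) ^ b) * H t)) := by
    have hbound : IntegrableOn (fun t : ℝ => ‖(t : ℂ) ^ ((1 - b) - 1) • (H t : ℂ)‖) (Ioi 0) :=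
      (mellinConvergent_of_bounded (B := B) (R := R) (Complex.measurable_ofReal.comp hH)
        (fun t => by simpa using hB t)
        (fun t ht => by simp [hR t (ht.trans_le (le_abs_self t))]) (by simpa using hb1)).norm
    refine tendsto_integral_filter_of_dominated_convergence
      (fun t => (2 * Real.exp (Real.pi * |b.im|)) * ‖(t : ℂ) ^ ((1 - b) - 1) • (H t : ℂ)‖) ?_ ?_
      (hbound.const_mul _) ?_
    · refine Eventually.of_forall fun ε => Measurable.aestronglyMeasurable ?_
      fun_prop
    · refine Eventually.of_forall fun ε => ?_
      filter_upwards [ae_restrict_mem measurableSet_Ioi] with t ht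
      have ht : 0 < t := ht
      rw [norm_mul, norm_smul, ← mul_assoc]
      refine mul_le_mul_of_nonneg_right ((norm_add_le _ _).trans ?_) (norm_nonneg _)
      have h1 := norm_inv_add_mul_I_cpow_le hb0 ε ht.ne'
      have h2 := norm_inv_add_mul_I_cpow_le hb0 ε (neg_ne_zero.2 ht.ne')
      rw [abs_neg] at h2
      rw [Complex.norm_cpow_eq_rpow_re_of_pos ht, two_mul, add_mul]
      rw [abs_of_pos ht] at h1 h2
      have h3 : (1 - b - 1).re = -b.re := by simp
      rw [h3]
      exact add_le_add h1 h2
    · filter_upwards [ae_restrict_mem measurableSet_Ioi] with t ht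
      have ht : 0 < t := ht
      have hc : ∀ s : ℝ, s ≠ 0 → Tendsto (fun ε : ℝ => (1 / ((ε : ℂ) + s * Complex.I)) ^ b)
          (𝓝[>] 0) (𝓝 ((1 / (s * Complex.I)) ^ b)) := by
        intro s hs
        have hsl : 1 / ((s : ℂ) * Complex.I) ∈ Complex.slitPlane := by
          refine Complex.mem_slitPlane_iff.2 (Or.inr ?_)
          simpa [Complex.inv_im] using hs
        have h1 : ContinuousAt (fun ε : ℝ => 1 / ((ε : ℂ) + s * Complex.I)) 0 := by
          refine continuousAt_const.div (by fun_prop) ?_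
          simpa using hs
        have h2 : ContinuousAt (fun ε : ℝ => (1 / ((ε : ℂ) + s * Complex.I)) ^ b) 0 :=
          h1.cpow continuousAt_const (by simpa using hsl)
        simpa using h2.tendsto.mono_left nhdsWithin_le_nhds
      exact ((hc t ht.ne').add (hc (-t) (neg_ne_zero.2 ht.ne'))).mul_const _
  have h5 : ∫ t in Ioi (0 : ℝ),
        ((1 / ((t : ℂ) * Complex.I)) ^ b + (1 / ((-t : ℝ) * Complex.I)) ^ b) * H t =
      2 * Complex.cos (b * Real.pi / 2) * mellin (fun t => (H t : ℂ)) (1 - b) := by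
    rw [mellin, ← integral_const_mul]
    refine setIntegral_congr_fun measurableSet_Ioi fun t ht => ?_
    simp only [smul_eq_mul]
    rw [one_div_mul_I_cpow_add ht, sub_sub_cancel_left]
    ring
  rw [mul_assoc, ← h5]
  refine tendsto_nhds_unique hlim1 ?_
  refine (hlim2.const_mul (Complex.Gamma b)).congr' ?_
  filter_upwards [self_mem_nhdsWithin] with ε hε using (hreg ε hε).symm

end CosineTransform

/-! ### Radial profiles of the gauge and the identity in the strip `-1 < Re q < 0` -/

section Profile

variable {E : Type*} [NormedAddCommGroup E] [InnerProductSpace ℝ E] [FiniteDimensional ℝ E]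
  [MeasurableSpace E] [BorelSpace E] {ξ : E} {N : E → ℝ} {η : ℝ → ℝ}

namespace IsSmoothGauge

theorem measurable_sectionIntegral (hN : IsSmoothGauge N) (hη : Continuous η) :
    Measurable (sectionIntegral N η ξ) := by
  have : Continuous fun p : ℝ × (ℝ ∙ ξ)ᗮ => η (N ((p.2 : E) + p.1 • ξ)) :=
    hη.comp (hN.continuous.comp (by fun_prop))
  exact this.stronglyMeasurable.integral_prod_right'.measurable

theorem exists_abs_sectionIntegral_le (hN : IsSmoothGauge N) (hξ : ‖ξ‖ = 1)
    (hη : ContDiff ℝ ∞ η) (hηc : HasCompactSupport η) :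
    ∃ B, ∀ t, |sectionIntegral N η ξ t| ≤ B := by
  obtain ⟨B, hB⟩ := hN.exists_sectionVolume_le hξ
  have hc : Continuous fun s : ℝ => |deriv η s| * (|s| ^ Module.finrank ℝ (ℝ ∙ ξ)ᗮ * B) := by
    have := hη.continuous_deriv (by simp)
    fun_prop
  have hcc : HasCompactSupport fun s : ℝ => |deriv η s| * (|s| ^ Module.finrank ℝ (ℝ ∙ ξ)ᗮ * B) :=
    (hηc.deriv.abs).mul_right
  refine ⟨∫ s in Ioi (0 : ℝ), |deriv η s| * (|s| ^ Module.finrank ℝ (ℝ ∙ ξ)ᗮ * B), fun t => ?_⟩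
  rw [hN.sectionIntegral_eq hξ hη hηc, abs_neg, ← Real.norm_eq_abs]
  refine norm_integral_le_of_norm_le (hc.integrable_of_hasCompactSupport hcc).integrableOn
    (Eventually.of_forall fun s => ?_)
  rw [norm_mul, norm_mul, norm_pow]
  simp only [Real.norm_eq_abs]
  rw [abs_of_nonneg (sectionVolume_nonneg _)]
  gcongr
  exact hB _

theorem exists_sectionIntegral_eq_zero (hN : IsSmoothGauge N) (hξ : ‖ξ‖ = 1)
    (hηc : HasCompactSupport η) : ∃ R, ∀ t, R < |t| → sectionIntegral N η ξ t = 0 := by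
  obtain ⟨c, hc, hle⟩ := hN.exists_norm_le
  obtain ⟨R, hR⟩ := hηc.isCompact.bddAbove
  refine ⟨c⁻¹ * R, fun t ht => ?_⟩
  rw [sectionIntegral]
  refine integral_eq_zero_of_ae (Eventually.of_forall fun y => ?_)
  by_contra h
  have h1 : N (y + t • ξ) ≤ R := hR (subset_tsupport _ h)
  refine ht.not_ge ?_
  rw [le_inv_mul_iff₀ hc]
  exact (mul_le_mul_of_nonneg_left (abs_le_norm_orthogonal_add_smul hξ y t) hc.le).trans
    ((hle _).trans h1)

/-- Passing from the indicator of the body to the profile `η ∘ N` multiplies the Mellin transform of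
the section function by `(d + a) ∫ η(s) s^(d+a-1) ds`. -/
theorem mellin_sectionIntegral (hN : IsSmoothGauge N) (hξ : ‖ξ‖ = 1)
    (hη : ContDiff ℝ ∞ η) (hηc : HasCompactSupport η) (hsupp : tsupport η ⊆ Ioi 0) {a : ℂ}
    (ha : 0 < a.re) :
    mellin (fun t => (sectionIntegral N η ξ t : ℂ)) a =
      (Module.finrank ℝ (ℝ ∙ ξ)ᗮ + a) * mellin (fun s => (η s : ℂ))
        (Module.finrank ℝ (ℝ ∙ ξ)ᗮ + a) * mellin (fun t => (sectionVolume N ξ t : ℂ)) a := by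
  set d := Module.finrank ℝ (ℝ ∙ ξ)ᗮ
  obtain ⟨B, hB⟩ := hN.exists_sectionVolume_le hξ
  obtain ⟨R, hR0, hR⟩ := hN.exists_sectionVolume_eq_zero hξ
  have h1 := mellin_superposition (g := sectionVolume N ξ) (w := fun s => -(deriv η s * s ^ d))
    (hN.measurable_sectionVolume ξ) (B := B) (R := R)
    (fun t => by rw [abs_of_nonneg (sectionVolume_nonneg t)]; exact hB t)
    (fun t ht => hR t (ht.trans_le (le_abs_self t))) hR0.le
    (((hη.continuous_deriv (by simp)).mul (continuous_pow d)).neg)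
    ((hηc.deriv.mul_right).neg) ha
  have h2 : (fun t => (sectionIntegral N η ξ t : ℂ)) = fun t =>
      ((∫ s in Ioi (0 : ℝ), -(deriv η s * s ^ d) * sectionVolume N ξ (t / s) : ℝ) : ℂ) := by
    funext t
    rw [hN.sectionIntegral_eq hξ hη hηc, ← integral_neg]
    congr 2
    funext s
    ring
  have h3 : mellin (fun s => ((-(deriv η s * s ^ d) : ℝ) : ℂ)) (a + 1) =
      -mellin (fun s => ((deriv η s : ℝ) : ℂ)) (d + a + 1) := by
    have h4 : mellin (fun s => ((deriv η s : ℝ) : ℂ)) (d + a + 1) =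
        mellin (fun s : ℝ => (s : ℂ) ^ (d : ℂ) • ((deriv η s : ℝ) : ℂ)) (a + 1) := by
      rw [mellin_cpow_smul]
      congr 1
      ring
    rw [h4, mellin, mellin, ← integral_neg]
    refine setIntegral_congr_fun measurableSet_Ioi fun s _ => ?_
    simp only [Complex.cpow_natCast, smul_eq_mul]
    push_cast
    ring
  have hofReal : HasCompactSupport fun s => (η s : ℂ) := hηc.comp_left Complex.ofReal_zero
  have hts : tsupport (fun s => (η s : ℂ)) ⊆ Ioi 0 :=
    (closure_mono (t := Function.support η) fun s hs =>
      Complex.ofReal_ne_zero.1 (Function.mem_support.1 hs)).trans hsupp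
  have h4 : mellin (fun s => ((deriv η s : ℝ) : ℂ)) (d + a + 1) =
      -((d + a) * mellin (fun s => (η s : ℂ)) (d + a)) :=
    mellin_deriv_add_one
      (fun t => ((hη.differentiable (by simp)) t).hasDerivAt.ofReal_comp)
      (Complex.continuous_ofReal.comp (hη.continuous_deriv (by simp))) hofReal hts _
  rw [h2, h1, h3, h4, neg_neg]

end IsSmoothGauge

end Profile

section Transform

variable {n : ℕ} {ξ : EuclideanSpace ℝ (Fin n)} {N : EuclideanSpace ℝ (Fin n) → ℝ} {η : ℝ → ℝ}

namespace IsSmoothGauge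

/-- On a line through the origin the Fourier transform of `h = η ∘ N` is the one-dimensional
Fourier transform of the integrals of `h` over the orthogonal hyperplanes. -/
theorem schwartzFourier_smul_eq (hξ : ‖ξ‖ = 1)
    {h : 𝓢(EuclideanSpace ℝ (Fin n), ℂ)} (hh : ∀ x, h x = (η (N x) : ℂ)) (u : ℝ) :
    schwartzFourier n h (u • ξ) =
      ∫ t : ℝ, Complex.exp (-Complex.I * (t * u : ℝ)) * sectionIntegral N η ξ t := by
  have hint : Integrable fun x => Complex.exp (-Complex.I * (inner ℝ x (u • ξ) : ℝ)) * h x := by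
    refine h.integrable.mono ?_ (Eventually.of_forall fun x => ?_)
    · exact (by fun_prop : Continuous fun x =>
        Complex.exp (-Complex.I * (inner ℝ x (u • ξ) : ℝ)) * h x).aestronglyMeasurable
    · rw [norm_mul, Complex.norm_exp]
      simp
  rw [schwartzFourier_apply, integral_eq_integral_slices hξ hint]
  refine integral_congr_ae (Eventually.of_forall fun t => ?_)
  simp only []
  rw [sectionIntegral, ← integral_complex_ofReal, ← integral_const_mul]
  refine integral_congr_ae (Eventually.of_forall fun y => ?_)
  have h1 : inner ℝ (y : EuclideanSpace ℝ (Fin n)) ξ = 0 := by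
    rw [real_inner_comm]
    exact Submodule.inner_right_of_mem_orthogonal (Submodule.mem_span_singleton_self ξ) y.2
  simp only [hh]
  rw [inner_smul_right, inner_add_left, h1, inner_smul_left, real_inner_self_eq_norm_sq, hξ]
  simp [mul_comm]

end IsSmoothGauge

theorem SchwartzMap.isBigO_smul_atTop {E : Type*} [NormedAddCommGroup E] [NormedSpace ℝ E]
    (φ : 𝓢(E, ℂ)) {x : E} (hx : x ≠ 0) (k : ℕ) :
    (fun u : ℝ => φ (u • x)) =O[atTop] (· ^ (-(k : ℝ))) := by
  obtain ⟨C, -, hC⟩ := φ.decay k 0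
  have hx0 : 0 < ‖x‖ := norm_pos_iff.2 hx
  refine Asymptotics.IsBigO.of_bound (C / ‖x‖ ^ k) ?_
  filter_upwards [eventually_gt_atTop 0] with u hu
  have := hC (u • x)
  rw [norm_iteratedFDeriv_zero, norm_smul, mul_pow, Real.norm_of_nonneg hu.le] at this
  rw [Real.rpow_neg hu.le, Real.rpow_natCast, norm_inv, norm_pow, Real.norm_of_nonneg hu.le,
    div_mul_eq_mul_div, le_div_iff₀ (by positivity), ← div_eq_mul_inv, le_div_iff₀ (by positivity)]
  linarith

theorem SchwartzMap.isBigO_smul_nhdsGT {E : Type*} [NormedAddCommGroup E] [NormedSpace ℝ E]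
    (φ : 𝓢(E, ℂ)) (x : E) :
    (fun u : ℝ => φ (u • x)) =O[𝓝[>] 0] (· ^ (-(0 : ℝ))) := by
  obtain ⟨C, -, hC⟩ := φ.decay 0 0
  refine Asymptotics.IsBigO.of_bound C (Eventually.of_forall fun u => ?_)
  simpa using hC (u • x)

theorem SchwartzMap.locallyIntegrableOn_smul {E : Type*} [NormedAddCommGroup E] [NormedSpace ℝ E]
    (φ : 𝓢(E, ℂ)) (x : E) : LocallyIntegrableOn (fun u : ℝ => φ (u • x)) (Ioi 0) :=
  (Continuous.locallyIntegrable (by fun_prop)).locallyIntegrableOn _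

theorem SchwartzMap.mellinConvergent_smul {E : Type*} [NormedAddCommGroup E] [NormedSpace ℝ E]
    (φ : 𝓢(E, ℂ)) {x : E} (hx : x ≠ 0) {s : ℂ} (hs : 0 < s.re) :
    MellinConvergent (fun u : ℝ => φ (u • x)) s := by
  obtain ⟨k, hk⟩ := exists_nat_gt s.re
  exact mellinConvergent_of_isBigO_rpow (φ.locallyIntegrableOn_smul x) (φ.isBigO_smul_atTop hx k) hk
    (φ.isBigO_smul_nhdsGT x) hs

theorem SchwartzMap.differentiableAt_mellin_smul {E : Type*} [NormedAddCommGroup E]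
    [NormedSpace ℝ E] (φ : 𝓢(E, ℂ)) {x : E} (hx : x ≠ 0) {s : ℂ} (hs : 0 < s.re) :
    DifferentiableAt ℂ (mellin (fun u : ℝ => φ (u • x))) s := by
  obtain ⟨k, hk⟩ := exists_nat_gt s.re
  exact mellin_differentiableAt_of_isBigO_rpow (φ.locallyIntegrableOn_smul x)
    (φ.isBigO_smul_atTop hx k) hk (φ.isBigO_smul_nhdsGT x) hs

/-- The identity of the theorem in the strip `-1 < Re q < 0`, where no regularization of the pairing
`⟨t_+^(-q-1), A_ξ⟩` is needed. -/
theorem IsSmoothGauge.mellin_schwartzFourier_smul (hN : IsSmoothGauge N) (hξ : ‖ξ‖ = 1)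
    (hη : ContDiff ℝ ∞ η) (hηc : HasCompactSupport η) (hsupp : tsupport η ⊆ Ioi 0)
    {h : 𝓢(EuclideanSpace ℝ (Fin n), ℂ)} (hh : ∀ x, h x = (η (N x) : ℂ)) {q : ℂ}
    (hq : -1 < q.re) (hq0 : q.re < 0) :
    mellin (fun u : ℝ => schwartzFourier n h (u • ξ)) (q + 1) =
      Complex.Gamma (q + 1) * (2 * Complex.cos ((q + 1) * Real.pi / 2)) *
        ((Module.finrank ℝ (ℝ ∙ ξ)ᗮ - q) * mellin (fun s => (η s : ℂ))
          (Module.finrank ℝ (ℝ ∙ ξ)ᗮ - q) * mellin (fun t => (sectionVolume N ξ t : ℂ)) (-q)) := by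
  have hξ0 : ξ ≠ 0 := by
    rintro rfl
    simp at hξ
  obtain ⟨B, hB⟩ := hN.exists_abs_sectionIntegral_le hξ hη hηc
  obtain ⟨R, hR⟩ := hN.exists_sectionIntegral_eq_zero hξ hηc
  have hconv := (schwartzFourier n h).mellinConvergent_smul hξ0 (s := q + 1)
    (by simp only [Complex.add_re, Complex.one_re]; linarith)
  have h1 := hN.mellin_sectionIntegral hξ hη hηc hsupp (a := -q) (by simpa using hq0)
  simp only [IsSmoothGauge.schwartzFourier_smul_eq hξ hh] at hconv ⊢
  rw [mellin_fourier_of_even (hN.measurable_sectionIntegral hη.continuous) hB hR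
    hN.sectionIntegral_neg (by simp only [Complex.add_re, Complex.one_re]; linarith)
    (by simp only [Complex.add_re, Complex.one_re]; linarith) hconv,
    show 1 - (q + 1) = -q by ring, h1, sub_eq_add_neg]

end Transform

/-! ### Fractional derivatives as Mellin transforms of Taylor remainders -/

section FractionalDerivative

theorem taylorSum_succ (m : ℕ) (g : ℝ → ℝ) (t : ℝ) :
    taylorSum (m + 1) g t = taylorSum m g t + iteratedDeriv m g 0 / m.factorial * t ^ m :=
  Finset.sum_range_succ _ _

theorem continuous_taylorSum (m : ℕ) (g : ℝ → ℝ) : Continuous (taylorSum m g) := by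
  unfold taylorSum
  fun_prop

/-- The function whose Mellin transform at `-q` is the sum of the two integrals in the regularized
pairing `⟨t_+^(-q-1), g⟩`. -/
noncomputable def taylorRemainder (m : ℕ) (g : ℝ → ℝ) (t : ℝ) : ℂ :=
  ((g t - (Iic 1).indicator (taylorSum m g) t : ℝ) : ℂ)

/-- The product `(0 - q) (1 - q) ⋯ (m - 1 - q) ⟨t_+^(-q-1), g⟩`: it has no poles in `Re q < m`. -/
noncomputable def clearedPairing (m : ℕ) (g : ℝ → ℝ) (q : ℂ) : ℂ :=
  (∏ k ∈ Finset.range m, ((k : ℂ) - q)) * mellin (taylorRemainder m g) (-q) +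
    ∑ k ∈ Finset.range m, ((iteratedDeriv k g 0 : ℝ) : ℂ) / k.factorial *
      ∏ j ∈ (Finset.range m).erase k, ((j : ℂ) - q)

variable {g : ℝ → ℝ} {δ B R : ℝ}

theorem taylorRemainder_of_le (m : ℕ) {t : ℝ} (ht : t ≤ 1) :
    taylorRemainder m g t = ((g t - taylorSum m g t : ℝ) : ℂ) := by
  rw [taylorRemainder, indicator_of_mem (mem_Iic.2 ht)]

theorem taylorRemainder_of_lt (m : ℕ) {t : ℝ} (ht : 1 < t) : taylorRemainder m g t = g t := by
  rw [taylorRemainder, indicator_of_notMem fun h => ht.not_ge (mem_Iic.1 h), sub_zero]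

theorem taylorRemainder_isBigO (hδ : 0 < δ) (hg : ContDiffOn ℝ ∞ g (Ioo (-δ) δ)) (m : ℕ) :
    taylorRemainder m g =O[𝓝[>] 0] fun t : ℝ => t ^ (-(-(m : ℝ))) := by
  set b := min (δ / 2) 1
  have hb : 0 < b := by positivity
  have hbδ : b < δ := (min_le_left _ _).trans_lt (half_lt_self hδ)
  have hsub : Icc 0 b ⊆ Ioo (-δ) δ := fun t ht => ⟨by linarith [ht.1], by linarith [ht.2]⟩
  have hat : ContDiffAt ℝ ∞ g 0 := hg.contDiffAt (Ioo_mem_nhds (by linarith) hδ)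
  obtain ⟨C, hC⟩ := exists_taylor_mean_remainder_bound (n := m) hb.le
    ((hg.mono hsub).of_le (by exact_mod_cast le_top))
  have htaylor : ∀ t, taylorWithinEval g m (Icc 0 b) 0 t = taylorSum (m + 1) g t := by
    intro t
    rw [taylor_within_apply, taylorSum]
    refine Finset.sum_congr rfl fun k _ => ?_
    rw [iteratedDerivWithin_eq_iteratedDeriv (uniqueDiffOn_Icc hb)
      (hat.of_le (by exact_mod_cast le_top)) (left_mem_Icc.2 hb.le), sub_zero, smul_eq_mul]
    ring
  set a := iteratedDeriv m g 0 / m.factorial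
  refine Asymptotics.IsBigO.of_bound (|C| + |a|) ?_
  filter_upwards [Ioc_mem_nhdsGT hb] with t ht
  have ht1 : t ≤ 1 := ht.2.trans (min_le_right _ _)
  have h1 := hC t ⟨ht.1.le, ht.2⟩
  rw [htaylor, taylorSum_succ, sub_zero] at h1
  rw [taylorRemainder_of_le m ht1, Complex.norm_real, neg_neg, Real.rpow_natCast, norm_pow,
    Real.norm_of_nonneg ht.1.le]
  have h3 : g t - taylorSum m g t = (g t - (taylorSum m g t + a * t ^ m)) + a * t ^ m := by ring
  rw [h3, add_mul]
  refine (norm_add_le _ _).trans (add_le_add (h1.trans ?_) ?_)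
  · have : t ^ (m + 1) ≤ t ^ m := pow_le_pow_of_le_one ht.1.le ht1 (Nat.le_succ m)
    have h0 : 0 ≤ t ^ (m + 1) := pow_nonneg ht.1.le _
    calc C * t ^ (m + 1) ≤ |C| * t ^ (m + 1) := mul_le_mul_of_nonneg_right (le_abs_self C) h0
      _ ≤ |C| * t ^ m := mul_le_mul_of_nonneg_left this (abs_nonneg C)
  · rw [norm_mul, norm_pow, Real.norm_of_nonneg ht.1.le, Real.norm_eq_abs]

theorem taylorRemainder_eq_zero (hR : ∀ t, R < t → g t = 0) (m : ℕ) (t : ℝ) (ht : max R 1 < t) :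
    taylorRemainder m g t = 0 := by
  rw [taylorRemainder_of_lt m ((le_max_right _ _).trans_lt ht), hR t ((le_max_left _ _).trans_lt ht),
    Complex.ofReal_zero]

theorem locallyIntegrable_taylorRemainder (hm : Measurable g) (hB : ∀ t, |g t| ≤ B) (m : ℕ) :
    LocallyIntegrable (taylorRemainder m g) := by
  have h1 : LocallyIntegrable fun t => (g t : ℂ) :=
    locallyIntegrable_of_bounded (Complex.measurable_ofReal.comp hm) fun t => by simpa using hB t
  have h2 : LocallyIntegrable ((Iic 1).indicator fun t => (taylorSum m g t : ℂ)) :=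
    ((Complex.continuous_ofReal.comp (continuous_taylorSum m g)).locallyIntegrable).indicator
      measurableSet_Iic
  refine (h1.sub h2).congr (Eventually.of_forall fun t => ?_)
  by_cases ht : t ∈ Iic (1 : ℝ) <;> simp [taylorRemainder, ht]

theorem mellinConvergent_taylorRemainder (hm : Measurable g) (hB : ∀ t, |g t| ≤ B)
    (hR : ∀ t, R < t → g t = 0) (hδ : 0 < δ) (hg : ContDiffOn ℝ ∞ g (Ioo (-δ) δ)) {m : ℕ} {q : ℂ}
    (hq : q.re < m) : MellinConvergent (taylorRemainder m g) (-q) :=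
  mellinConvergent_of_isBigO_rpow ((locallyIntegrable_taylorRemainder hm hB m).locallyIntegrableOn _)
    (isBigO_atTop_of_eq_zero (taylorRemainder_eq_zero hR m) _) (lt_add_one _)
    (taylorRemainder_isBigO hδ hg m) (by simpa using hq)

theorem differentiableAt_mellin_taylorRemainder (hm : Measurable g) (hB : ∀ t, |g t| ≤ B)
    (hR : ∀ t, R < t → g t = 0) (hδ : 0 < δ) (hg : ContDiffOn ℝ ∞ g (Ioo (-δ) δ)) {m : ℕ} {q : ℂ}
    (hq : q.re < m) : DifferentiableAt ℂ (mellin (taylorRemainder m g)) (-q) :=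
  mellin_differentiableAt_of_isBigO_rpow
    ((locallyIntegrable_taylorRemainder hm hB m).locallyIntegrableOn _)
    (isBigO_atTop_of_eq_zero (taylorRemainder_eq_zero hR m) _) (lt_add_one _)
    (taylorRemainder_isBigO hδ hg m) (by simpa using hq)

theorem differentiableAt_clearedPairing (hm : Measurable g) (hB : ∀ t, |g t| ≤ B)
    (hR : ∀ t, R < t → g t = 0) (hδ : 0 < δ) (hg : ContDiffOn ℝ ∞ g (Ioo (-δ) δ)) {m : ℕ} {q : ℂ}
    (hq : q.re < m) : DifferentiableAt ℂ (clearedPairing m g) q := by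
  have h1 : DifferentiableAt ℂ (fun q => mellin (taylorRemainder m g) (-q)) q :=
    (differentiableAt_mellin_taylorRemainder hm hB hR hδ hg hq).comp q differentiableAt_id.neg
  unfold clearedPairing
  fun_prop

theorem integrableOn_Ioc_taylor (hm : Measurable g) (hB : ∀ t, |g t| ≤ B)
    (hR : ∀ t, R < t → g t = 0) (hδ : 0 < δ) (hg : ContDiffOn ℝ ∞ g (Ioo (-δ) δ)) {m : ℕ} {q : ℂ}
    (hq : q.re < m) :
    IntegrableOn (fun t : ℝ => (t : ℂ) ^ (-q - 1) * ((g t - taylorSum m g t : ℝ) : ℂ)) (Ioc 0 1) := by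
  refine ((mellinConvergent_taylorRemainder hm hB hR hδ hg hq).mono_set
    Ioc_subset_Ioi_self).congr_fun (fun t ht => ?_) measurableSet_Ioc
  simp only [taylorRemainder_of_le m ht.2, smul_eq_mul]

theorem integrableOn_Ioi_one (hm : Measurable g) (hB : ∀ t, |g t| ≤ B)
    (hR : ∀ t, R < t → g t = 0) (hδ : 0 < δ) (hg : ContDiffOn ℝ ∞ g (Ioo (-δ) δ)) {m : ℕ} {q : ℂ}
    (hq : q.re < m) : IntegrableOn (fun t : ℝ => (t : ℂ) ^ (-q - 1) * (g t : ℂ)) (Ioi 1) := by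
  refine ((mellinConvergent_taylorRemainder hm hB hR hδ hg hq).mono_set
    (Ioi_subset_Ioi zero_le_one)).congr_fun (fun t ht => ?_) measurableSet_Ioi
  simp only [taylorRemainder_of_lt m ht, smul_eq_mul]

theorem regularizedPairing_eq_mellin (hm : Measurable g) (hB : ∀ t, |g t| ≤ B)
    (hR : ∀ t, R < t → g t = 0) (hδ : 0 < δ) (hg : ContDiffOn ℝ ∞ g (Ioo (-δ) δ)) {m : ℕ} {q : ℂ}
    (hq : q.re < m) :
    regularizedPairing m (-q - 1) g = mellin (taylorRemainder m g) (-q) +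
      ∑ k ∈ Finset.range m, ((iteratedDeriv k g 0 : ℝ) : ℂ) / k.factorial * (1 / ((k : ℂ) - q)) := by
  have h1 := mellinConvergent_taylorRemainder hm hB hR hδ hg hq
  rw [regularizedPairing, mellin, ← Ioc_union_Ioi_eq_Ioi zero_le_one,
    setIntegral_union Ioc_disjoint_Ioi_same measurableSet_Ioi (h1.mono_set Ioc_subset_Ioi_self)
      (h1.mono_set (Ioi_subset_Ioi zero_le_one))]
  congr 1
  · congr 1
    · refine setIntegral_congr_fun measurableSet_Ioc fun t ht => ?_
      simp only [taylorRemainder_of_le m ht.2, smul_eq_mul]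
    · refine setIntegral_congr_fun measurableSet_Ioi fun t ht => ?_
      simp only [taylorRemainder_of_lt m ht, smul_eq_mul]
  · refine Finset.sum_congr rfl fun k _ => ?_
    rw [div_mul_div_comm, mul_one]
    congr 2
    ring

/-- The regularized pairing does not depend on the number of Taylor terms. -/
theorem regularizedPairing_eq_of_le (hm : Measurable g) (hB : ∀ t, |g t| ≤ B)
    (hR : ∀ t, R < t → g t = 0) (hδ : 0 < δ) (hg : ContDiffOn ℝ ∞ g (Ioo (-δ) δ)) {m M : ℕ} {q : ℂ}
    (hq : q.re < m) (hmM : m ≤ M) :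
    regularizedPairing M (-q - 1) g = regularizedPairing m (-q - 1) g := by
  induction M, hmM using Nat.le_induction with
  | base => rfl
  | succ M hmM ih =>
    have hqM : q.re < M := hq.trans_le (by exact_mod_cast hmM)
    have hqM' : q.re < (M + 1 : ℕ) := hqM.trans (by simp)
    rw [← ih, regularizedPairing_eq_mellin hm hB hR hδ hg hqM,
      regularizedPairing_eq_mellin hm hB hR hδ hg hqM', Finset.sum_range_succ, add_comm (∑ k ∈ _, _),
      ← add_assoc]
    congr 1
    have h1 := hasMellin_cpow_Ioc (M : ℂ) (s := -q) (by simpa using hqM)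
    have h2 := mellinConvergent_taylorRemainder hm hB hR hδ hg hqM'
    have h3 := (hasMellin_add h2 (h1.1.const_smul
      (((iteratedDeriv M g 0 : ℝ) : ℂ) / M.factorial))).2
    rw [mellin_const_smul, h1.2, smul_eq_mul, show -q + (M : ℂ) = M - q by ring] at h3
    rw [← h3]
    refine setIntegral_congr_fun measurableSet_Ioi fun t ht => ?_
    have ht : 0 < t := ht
    simp only []
    congr 1
    by_cases ht1 : t ≤ 1
    · rw [taylorRemainder_of_le _ ht1, taylorRemainder_of_le _ ht1,
        indicator_of_mem (show t ∈ Ioc (0 : ℝ) 1 from ⟨ht, ht1⟩), taylorSum_succ, Complex.cpow_natCast,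
        smul_eq_mul]
      push_cast
      ring
    · rw [taylorRemainder_of_lt _ (not_le.1 ht1), taylorRemainder_of_lt _ (not_le.1 ht1),
        indicator_of_notMem (show t ∉ Ioc (0 : ℝ) 1 from fun h => ht1 h.2), smul_zero, add_zero]

theorem Gamma_natCast_sub {q : ℂ} {m : ℕ} (h : ∀ k < m, (k : ℂ) - q ≠ 0) :
    Complex.Gamma (m - q) = (∏ k ∈ Finset.range m, ((k : ℂ) - q)) * Complex.Gamma (-q) := by
  induction m with
  | zero => simp
  | succ m ih =>
    rw [Finset.prod_range_succ, mul_right_comm, ← ih fun k hk => h k (hk.trans m.lt_succ_self),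
      Nat.cast_succ, add_sub_right_comm, Complex.Gamma_add_one _ (h m m.lt_succ_self), mul_comm]

/-- At non-integer orders the poles of `Γ(-q)` are moved to `Γ(M - q)`, which is holomorphic in
`Re q < M`, so that the right-hand side is the analytic continuation to the integers. -/
theorem fractionalDeriv_eq_of_ne (hm : Measurable g) (hB : ∀ t, |g t| ≤ B)
    (hR : ∀ t, R < t → g t = 0) (hδ : 0 < δ) (hg : ContDiffOn ℝ ∞ g (Ioo (-δ) δ)) {M : ℕ} {q : ℂ}
    (hq : -1 < q.re) (hqM : q.re < M) (hne : ∀ k : ℕ, (k : ℂ) ≠ q) :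
    fractionalDeriv g q = clearedPairing M g q / Complex.Gamma (M - q) := by
  have hre : -(-q - 1).re = q.re + 1 := by simp [add_comm]
  have hfl : ⌊q.re + 1⌋₊ ≤ M := by
    rw [← Nat.lt_add_one_iff, Nat.floor_lt (by linarith)]
    push_cast
    linarith
  have hfl' : q.re < ⌊q.re + 1⌋₊ := by linarith [Nat.lt_floor_add_one (q.re + 1)]
  rw [fractionalDeriv, normalizedPairing, hre, if_neg]
  · rw [← regularizedPairing_eq_of_le hm hB hR hδ hg hfl' hfl,
      regularizedPairing_eq_mellin hm hB hR hδ hg hqM,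
      Gamma_natCast_sub fun k _ => sub_ne_zero.2 (hne k), sub_add_cancel, ← div_div]
    congr 1
    have hprod : ∏ k ∈ Finset.range M, ((k : ℂ) - q) ≠ 0 :=
      Finset.prod_ne_zero_iff.2 fun k _ => sub_ne_zero.2 (hne k)
    rw [clearedPairing, eq_div_iff hprod, add_mul, mul_comm (mellin _ _), Finset.sum_mul]
    congr 1
    refine Finset.sum_congr rfl fun k hk => ?_
    rw [← Finset.mul_prod_erase _ _ hk, mul_assoc, ← mul_assoc (1 / _), one_div,
      inv_mul_cancel₀ (sub_ne_zero.2 (hne k)), one_mul]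
  · rintro ⟨h1, h2⟩
    refine hne (⌊q.re + 1⌋₊ - 1) ?_
    rw [Nat.cast_sub h1]
    push_cast
    linear_combination h2

/-- At the integer order `j` the continuation has the value prescribed in `normalizedPairing`: of
the cleared pairing only the Taylor coefficient of degree `j` is left. -/
theorem fractionalDeriv_natCast (g : ℝ → ℝ) (j : ℕ) :
    fractionalDeriv g j = clearedPairing (j + 1) g j / Complex.Gamma ((j + 1 : ℕ) - j) := by
  have hre : -(-(j : ℂ) - 1).re = (j + 1 : ℕ) := by simp [add_comm]
  rw [fractionalDeriv, normalizedPairing, hre, Nat.floor_natCast, if_pos ⟨by omega, by push_cast; ring⟩,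
    Nat.add_sub_cancel, Nat.cast_succ, add_sub_cancel_left, Complex.Gamma_one, div_one,
    clearedPairing, Finset.prod_eq_zero (Finset.self_mem_range_succ j) (sub_self _), zero_mul,
    zero_add, Finset.sum_range_succ, Finset.sum_eq_zero, zero_add]
  · have h1 : (Finset.range (j + 1)).erase j = Finset.range j := by
      rw [Finset.range_add_one, Finset.erase_insert Finset.notMem_range_self]
    have h2 : ∏ i ∈ Finset.range j, ((i : ℂ) - j) = (-1) ^ j * j.factorial := by
      rw [← Finset.prod_range_reflect, ← Finset.prod_range_add_one_eq_factorial]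
      push_cast
      rw [← Finset.card_range j, ← Finset.prod_const, Finset.card_range, ← Finset.prod_mul_distrib]
      refine Finset.prod_congr rfl fun i hi => ?_
      have hi : i + 1 ≤ j := Finset.mem_range.1 hi
      rw [Nat.sub_sub, add_comm 1 i, Nat.cast_sub hi]
      push_cast
      ring
    have h3 : (j.factorial : ℂ) ≠ 0 := by exact_mod_cast j.factorial_ne_zero
    rw [h1, h2]
    field_simp
  · intro k hk
    rw [Finset.prod_eq_zero (i := j), mul_zero]
    · have := Finset.mem_range.1 hk
      simp [this.ne']
    · simp

end FractionalDerivative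

/-! ### Analytic continuation in the order -/

section Continuation

/-- Euler's reflection formula, in the form that relates the factor `1 / Γ(-z)` of the fractional
derivative to the factor of the cosine transform. -/
theorem Complex.pi_div_Gamma_neg {z : ℂ} (hz : -1 < z.re) (hz0 : z.re < 0) :
    Real.pi / Complex.Gamma (-z) = Complex.cos (z * Real.pi / 2) *
      (Complex.Gamma (z + 1) * (2 * Complex.cos ((z + 1) * Real.pi / 2))) := by
  have h1 : Complex.Gamma (-z) ≠ 0 := Complex.Gamma_ne_zero_of_re_pos (by simpa using hz0)
  have h2 : Complex.Gamma (z + 1) ≠ 0 := Complex.Gamma_ne_zero_of_re_pos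
    (by simp only [Complex.add_re, Complex.one_re]; linarith)
  have h3 := Complex.Gamma_mul_Gamma_one_sub (-z)
  rw [show 1 - -z = z + 1 by ring] at h3
  have h4 : Complex.sin (Real.pi * -z) ≠ 0 := by
    intro h
    rw [h, div_zero] at h3
    exact mul_ne_zero h1 h2 h3
  rw [eq_div_iff h4] at h3
  have h5 : Complex.cos ((z + 1) * Real.pi / 2) = -Complex.sin (z * Real.pi / 2) := by
    rw [show (z + 1) * Real.pi / 2 = z * Real.pi / 2 + Real.pi / 2 by ring,
      Complex.cos_add_pi_div_two]
  have h6 : Complex.sin (Real.pi * -z) =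
      -(2 * Complex.sin (z * Real.pi / 2) * Complex.cos (z * Real.pi / 2)) := by
    rw [← Complex.sin_two_mul, ← Complex.sin_neg]
    congr 1
    ring
  rw [div_eq_iff h1, h5]
  rw [h6] at h3
  linear_combination -h3

variable {n : ℕ} {ξ : EuclideanSpace ℝ (Fin n)} {N : EuclideanSpace ℝ (Fin n) → ℝ} {η : ℝ → ℝ}

/-- The identity of the theorem for all `Re q > -1`, by analytic continuation in `q`. -/
theorem IsSmoothGauge.fractionalDeriv_sectionVolume (hN : IsSmoothGauge N) (hξ : ‖ξ‖ = 1)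
    (hη : ContDiff ℝ ∞ η) (hηc : HasCompactSupport η) (hsupp : tsupport η ⊆ Ioi 0)
    {h : 𝓢(EuclideanSpace ℝ (Fin n), ℂ)} (hh : ∀ x, h x = (η (N x) : ℂ)) {q : ℂ}
    (hq : -1 < q.re) :
    mellin (fun s => (η s : ℂ)) (Module.finrank ℝ (ℝ ∙ ξ)ᗮ - q) *
      (Real.pi * (Module.finrank ℝ (ℝ ∙ ξ)ᗮ - q)) * fractionalDeriv (sectionVolume N ξ) q =
      Complex.cos (q * Real.pi / 2) *
        mellin (fun u : ℝ => schwartzFourier n h (u • ξ)) (q + 1) := by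
  set d := Module.finrank ℝ (ℝ ∙ ξ)ᗮ
  have hξ0 : ξ ≠ 0 := by
    rintro rfl
    simp at hξ
  obtain ⟨δ, hδ, hg⟩ := hN.contDiffOn_sectionVolume hξ
  obtain ⟨B, hB'⟩ := hN.exists_sectionVolume_le hξ
  obtain ⟨R, -, hR'⟩ := hN.exists_sectionVolume_eq_zero hξ
  have hm := hN.measurable_sectionVolume ξ
  have hB : ∀ t, |sectionVolume N ξ t| ≤ B := fun t => by
    rw [abs_of_nonneg (sectionVolume_nonneg t)]
    exact hB' t
  have hR : ∀ t, R < t → sectionVolume N ξ t = 0 := fun t ht =>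
    hR' t (ht.trans_le (le_abs_self t))
  set M := ⌊q.re + 1⌋₊
  have hqM : q.re < M := by linarith [Nat.lt_floor_add_one (q.re + 1)]
  have hηc' : HasCompactSupport fun s => (η s : ℂ) := hηc.comp_left Complex.ofReal_zero
  have hts : tsupport (fun s => (η s : ℂ)) ⊆ Ioi 0 :=
    (closure_mono (t := Function.support η) fun s hs =>
      Complex.ofReal_ne_zero.1 (Function.mem_support.1 hs)).trans hsupp
  have hc : Differentiable ℂ (mellin fun s => (η s : ℂ)) :=
    differentiable_mellin_of_tsupport_subset (Complex.continuous_ofReal.comp hη.continuous) hηc' hts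
  set U : Set ℂ := {z | -1 < z.re ∧ z.re < M} with hU
  have hUo : IsOpen U := (isOpen_lt continuous_const Complex.continuous_re).inter
    (isOpen_lt Complex.continuous_re continuous_const)
  have hUc : IsPreconnected U :=
    ((convex_halfSpace_re_gt (-1)).inter (convex_halfSpace_re_lt M)).isPreconnected
  set L : ℂ → ℂ := fun z => mellin (fun s => (η s : ℂ)) (d - z) * (Real.pi * (d - z)) *
    (clearedPairing M (sectionVolume N ξ) z * (Complex.Gamma (M - z))⁻¹) with hL
  set P : ℂ → ℂ := fun z => Complex.cos (z * Real.pi / 2) *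
    mellin (fun u : ℝ => schwartzFourier n h (u • ξ)) (z + 1) with hP
  have hLd : AnalyticOnNhd ℂ L U := by
    refine DifferentiableOn.analyticOnNhd (fun z hz => ?_) hUo
    have h1 : DifferentiableAt ℂ (fun z => mellin (fun s => (η s : ℂ)) (d - z)) z :=
      (hc _).comp z (differentiableAt_id.const_sub _)
    have h2 : DifferentiableAt ℂ (fun z => (Complex.Gamma (M - z))⁻¹) z :=
      (Complex.differentiable_one_div_Gamma _).comp z (differentiableAt_id.const_sub _)
    have h3 := differentiableAt_clearedPairing hm hB hR hδ hg hz.2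
    exact (by fun_prop : DifferentiableAt ℂ L z).differentiableWithinAt
  have hPd : AnalyticOnNhd ℂ P U := by
    refine DifferentiableOn.analyticOnNhd (fun z hz => ?_) hUo
    have h1 : DifferentiableAt ℂ
        (fun z => mellin (fun u : ℝ => schwartzFourier n h (u • ξ)) (z + 1)) z :=
      ((schwartzFourier n h).differentiableAt_mellin_smul hξ0
        (by simp only [Complex.add_re, Complex.one_re]; linarith [hz.1])).comp z
        (differentiableAt_id.add_const _)
    exact (by fun_prop : DifferentiableAt ℂ P z).differentiableWithinAt
  have hbase : ∀ z : ℂ, -1 < z.re → z.re < 0 → L z = P z := by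
    intro z hz hz0
    have hne : ∀ k : ℕ, (k : ℂ) ≠ z := by
      rintro k rfl
      simp only [Complex.natCast_re] at hz0
      exact absurd hz0 (not_lt.2 k.cast_nonneg)
    have hzM : z.re < M := hz0.trans_le M.cast_nonneg
    have h1 := fractionalDeriv_eq_of_ne hm hB hR hδ hg hz hzM hne
    have h2 := fractionalDeriv_eq_of_ne (M := 0) hm hB hR hδ hg hz (by simpa using hz0) hne
    have h3 : clearedPairing 0 (sectionVolume N ξ) z =
        mellin (fun t => (sectionVolume N ξ t : ℂ)) (-z) := by
      have : taylorRemainder 0 (sectionVolume N ξ) = fun t => (sectionVolume N ξ t : ℂ) := by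
        funext t
        simp [taylorRemainder, taylorSum, indicator]
      simp [clearedPairing, this]
    simp only [hL, hP]
    rw [hN.mellin_schwartzFourier_smul hξ hη hηc hsupp hh hz hz0, ← div_eq_mul_inv, ← h1, h2, h3,
      Nat.cast_zero, zero_sub, ← mul_assoc (Complex.cos _), ← Complex.pi_div_Gamma_neg hz hz0]
    ring
  have hmem : q ∈ U := ⟨hq, hqM⟩
  have heq : L q = P q := by
    have h0 : (-1 / 2 : ℂ).re = -1 / 2 := by norm_num
    refine hLd.eqOn_of_preconnected_of_eventuallyEq hPd hUc (z₀ := (-1 / 2 : ℂ)) ?_ ?_ hmem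
    · refine ⟨by rw [h0]; norm_num, ?_⟩
      rw [h0]
      exact lt_of_lt_of_le (by norm_num) M.cast_nonneg
    · have : {z : ℂ | -1 < z.re ∧ z.re < 0} ∈ 𝓝 (-1 / 2 : ℂ) :=
        ((isOpen_lt continuous_const Complex.continuous_re).inter
          (isOpen_lt Complex.continuous_re continuous_const)).mem_nhds
          ⟨by rw [mem_ofPred_eq, h0]; norm_num, by rw [mem_ofPred_eq, h0]; norm_num⟩
      filter_upwards [this] with z hz using hbase z hz.1 hz.2
  have hfrac : fractionalDeriv (sectionVolume N ξ) q =
      clearedPairing M (sectionVolume N ξ) q / Complex.Gamma (M - q) := by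
    by_cases hne : ∃ j : ℕ, (j : ℂ) = q
    · obtain ⟨j, rfl⟩ := hne
      have : M = j + 1 := by
        simp only [M, Complex.natCast_re]
        rw [← Nat.cast_succ, Nat.floor_natCast]
      rw [this]
      exact fractionalDeriv_natCast _ j
    · push Not at hne
      exact fractionalDeriv_eq_of_ne hm hB hR hδ hg hq hqM hne
  rw [hfrac, div_eq_mul_inv]
  exact heq

theorem IsSmoothGauge.isFractionallyDifferentiable_sectionVolume {E : Type*}
    [NormedAddCommGroup E] [InnerProductSpace ℝ E] [FiniteDimensional ℝ E] [MeasurableSpace E]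
    [BorelSpace E] {ξ : E} {N : E → ℝ} (hN : IsSmoothGauge N) (hξ : ‖ξ‖ = 1) (q : ℂ) :
    IsFractionallyDifferentiable (sectionVolume N ξ) q := by
  obtain ⟨δ, hδ, hg⟩ := hN.contDiffOn_sectionVolume hξ
  obtain ⟨B, hB'⟩ := hN.exists_sectionVolume_le hξ
  obtain ⟨R, -, hR'⟩ := hN.exists_sectionVolume_eq_zero hξ
  have hm := hN.measurable_sectionVolume ξ
  have hB : ∀ t, |sectionVolume N ξ t| ≤ B := fun t => by
    rw [abs_of_nonneg (sectionVolume_nonneg t)]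
    exact hB' t
  have hR : ∀ t, R < t → sectionVolume N ξ t = 0 := fun t ht =>
    hR' t (ht.trans_le (le_abs_self t))
  have hqM : q.re < ⌊-(-q - 1).re⌋₊ := by
    have hre : -(-q - 1).re = q.re + 1 := by simp [add_comm]
    rw [hre]
    linarith [Nat.lt_floor_add_one (q.re + 1)]
  exact ⟨⟨_, Ioo_mem_nhds (by linarith) hδ, hg⟩, integrableOn_Ioc_taylor hm hB hR hδ hg hqM,
    integrableOn_Ioi_one hm hB hR hδ hg hqM⟩

end Continuation

/-! ### Powers of the gauge as tempered distributions -/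

section Distribution

/-- A function that is integrable against some negative power of `1 + ‖x‖` defines a tempered
distribution. -/
theorem exists_isDistributionOf {n : ℕ} {f : EuclideanSpace ℝ (Fin n) → ℂ}
    (hf : AEStronglyMeasurable f) (k : ℕ) (hint : Integrable fun x => ‖f x‖ * ((1 + ‖x‖) ^ k)⁻¹) :
    ∃ T, IsDistributionOf T f := by
  set S : 𝓢(EuclideanSpace ℝ (Fin n), ℂ) → ℝ := fun φ =>
    2 ^ k * ((Finset.Iic (k, 0)).sup fun m => SchwartzMap.seminorm ℂ m.1 m.2) φ
  have hle : ∀ (φ : 𝓢(EuclideanSpace ℝ (Fin n), ℂ)) x,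
      ‖f x * φ x‖ ≤ ‖f x‖ * ((1 + ‖x‖) ^ k)⁻¹ * S φ := by
    intro φ x
    have h1 := SchwartzMap.one_add_le_sup_seminorm_apply (𝕜 := ℂ) (m := (k, 0)) (k := k) (n := 0)
      le_rfl le_rfl φ x
    rw [norm_iteratedFDeriv_zero] at h1
    rw [norm_mul, mul_assoc]
    refine mul_le_mul_of_nonneg_left ?_ (norm_nonneg _)
    rwa [le_inv_mul_iff₀ (by positivity)]
  have hi : ∀ φ : 𝓢(EuclideanSpace ℝ (Fin n), ℂ), Integrable fun x => f x * φ x := fun φ =>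
    (hint.mul_const (S φ)).mono' (hf.mul φ.continuous.aestronglyMeasurable)
      (Eventually.of_forall (hle φ))
  set T : 𝓢(EuclideanSpace ℝ (Fin n), ℂ) →L[ℂ] ℂ :=
    SchwartzMap.mkCLMtoNormedSpace (fun φ => ∫ x, f x * φ x)
      (fun φ ψ => by
        rw [← integral_add (hi φ) (hi ψ)]
        simp [mul_add])
      (fun a φ => by
        rw [RingHom.id_apply, smul_eq_mul, ← integral_const_mul]
        refine integral_congr_ae (Eventually.of_forall fun x => ?_)
        simp only [smul_apply, smul_eq_mul]
        ring)
      ⟨Finset.Iic (k, 0), (∫ x, ‖f x‖ * ((1 + ‖x‖) ^ k)⁻¹) * 2 ^ k, by positivity, fun φ => by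
        refine (norm_integral_le_of_norm_le (hint.mul_const (S φ))
          (Eventually.of_forall (hle φ))).trans_eq ?_
        rw [integral_mul_const, mul_assoc]
        rfl⟩
  exact ⟨ContinuousLinearMap.toPointwiseConvergenceCLM _ _ _ _ T, fun φ => ⟨hi φ, rfl⟩⟩

variable {n : ℕ} {N : EuclideanSpace ℝ (Fin n) → ℝ}

theorem IsSmoothGauge.exists_rpow_le {E : Type*} [NormedAddCommGroup E] [NormedSpace ℝ E]
    [FiniteDimensional ℝ E] {N : E → ℝ} (hN : IsSmoothGauge N) (a : ℝ) :
    ∃ C, ∀ x, x ≠ 0 → N x ^ a ≤ C * ‖x‖ ^ a := by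
  rcases le_or_gt 0 a with ha | ha
  · obtain ⟨C, hC, h⟩ := hN.exists_le_norm
    refine ⟨C ^ a, fun x _ => ?_⟩
    rw [← Real.mul_rpow hC.le (norm_nonneg x)]
    exact Real.rpow_le_rpow (hN.nonneg x) (h x) ha
  · obtain ⟨c, hc, h⟩ := hN.exists_norm_le
    refine ⟨c ^ a, fun x hx => ?_⟩
    have : 0 < ‖x‖ := norm_pos_iff.2 hx
    rw [← Real.mul_rpow hc.le this.le]
    exact Real.rpow_le_rpow_of_nonpos (by positivity) (h x) ha.le

theorem integrableOn_rpow_mul_inv_one_add_pow {s : ℝ} (hs : 0 < s) {k : ℕ} (hk : s < k) {r : ℝ}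
    (hr : 0 < r) : IntegrableOn (fun y : ℝ => y ^ (s - 1) * ((1 + r * y) ^ k)⁻¹) (Ioi 0) := by
  have hloc : LocallyIntegrableOn (fun y : ℝ => ((1 + r * y) ^ k)⁻¹) (Ioi 0) := by
    refine ContinuousOn.locallyIntegrableOn (fun y hy => ?_) measurableSet_Ioi
    have hy : 0 < y := hy
    exact ContinuousAt.continuousWithinAt (ContinuousAt.inv₀ (by fun_prop) (by positivity))
  refine mellin_convergent_of_isBigO_scalar (a := k) (b := 0) hloc ?_ hk ?_ hs
  · refine Asymptotics.IsBigO.of_bound (r ^ k)⁻¹ ?_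
    filter_upwards [eventually_gt_atTop 0] with y hy
    rw [Real.rpow_neg hy.le, Real.rpow_natCast, norm_inv, norm_inv, norm_pow, norm_pow,
      Real.norm_of_nonneg hy.le, Real.norm_of_nonneg (by positivity), ← mul_inv, ← mul_pow]
    gcongr
    linarith
  · refine Asymptotics.IsBigO.of_bound 1 ?_
    filter_upwards [self_mem_nhdsWithin] with y hy
    have hy : 0 < y := hy
    rw [neg_zero, Real.rpow_zero, norm_one, mul_one, norm_inv, norm_pow,
      Real.norm_of_nonneg (by positivity)]
    exact inv_le_one_of_one_le₀ (one_le_pow₀ (by linarith [mul_pos hr hy]))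

theorem integrable_norm_rpow_mul {E : Type*} [NormedAddCommGroup E] [NormedSpace ℝ E]
    [FiniteDimensional ℝ E] [MeasurableSpace E] [BorelSpace E] [Nontrivial E] (μ : Measure E)
    [μ.IsAddHaarMeasure] {a : ℝ} (ha : -(Module.finrank ℝ E : ℝ) < a) {k : ℕ}
    (hk : a + Module.finrank ℝ E < k) : Integrable (fun x : E => ‖x‖ ^ a * ((1 + ‖x‖) ^ k)⁻¹) μ := by
  rw [integrable_fun_norm_addHaar μ (f := fun y => y ^ a * ((1 + y) ^ k)⁻¹)]
  refine (integrableOn_rpow_mul_inv_one_add_pow (s := a + Module.finrank ℝ E) (by linarith) hk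
    one_pos).congr_fun (fun y hy => ?_) measurableSet_Ioi
  have hy : 0 < y := hy
  have hd : 0 < Module.finrank ℝ E := Module.finrank_pos
  simp only [smul_eq_mul, one_mul]
  rw [← mul_assoc, ← Real.rpow_natCast y, ← Real.rpow_add hy, Nat.cast_sub hd]
  congr 2
  push_cast
  ring

theorem IsSmoothGauge.exists_isDistributionOf_cpow (hn : 0 < n) (hN : IsSmoothGauge N) {p : ℂ}
    (hp : -(n : ℝ) < p.re) : ∃ T, IsDistributionOf T fun x => (N x : ℂ) ^ p := by
  have : NeZero n := ⟨hn.ne'⟩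
  obtain ⟨k, hk⟩ := exists_nat_gt (p.re + n)
  obtain ⟨C, hC⟩ := hN.exists_rpow_le p.re
  have hmeas : Measurable fun x => (N x : ℂ) ^ p :=
    (Complex.measurable_ofReal.comp hN.continuous.measurable).pow_const p
  refine exists_isDistributionOf hmeas.aestronglyMeasurable k ?_
  have h1 := (integrable_norm_rpow_mul (volume : Measure (EuclideanSpace ℝ (Fin n)))
    (a := p.re) (k := k) (by simpa using hp) (by simpa using hk)).const_mul C
  refine h1.mono' (by fun_prop) ?_
  filter_upwards [compl_mem_ae_iff.2 (measure_singleton (0 : EuclideanSpace ℝ (Fin n)))] with x hx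
  rw [Real.norm_of_nonneg (by positivity), ← mul_assoc,
    Complex.norm_cpow_eq_rpow_re_of_pos (hN.pos x hx)]
  exact mul_le_mul_of_nonneg_right (hC x hx) (by positivity)

end Distribution

/-! ### The Fourier transform of a power of the gauge away from the origin -/

section OffZero

theorem SchwartzMap.exists_norm_le_inv_one_add_pow {E : Type*} [NormedAddCommGroup E]
    [NormedSpace ℝ E] (φ : 𝓢(E, ℂ)) (k : ℕ) :
    ∃ C, ∀ x, ‖φ x‖ ≤ C * ((1 + ‖x‖) ^ k)⁻¹ := by
  refine ⟨2 ^ k * ((Finset.Iic (k, 0)).sup fun m => SchwartzMap.seminorm ℂ m.1 m.2) φ, fun x => ?_⟩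
  have h1 := SchwartzMap.one_add_le_sup_seminorm_apply (𝕜 := ℂ) (m := (k, 0)) (k := k) (n := 0)
    le_rfl le_rfl φ x
  rw [norm_iteratedFDeriv_zero] at h1
  rw [mul_comm _ (_)⁻¹]
  rwa [le_inv_mul_iff₀ (by positivity)]

/-- A bound for the Mellin integrand `u ^ (s - 1) φ(u x)`, uniform in `‖x‖ ≥ r`. -/
theorem SchwartzMap.exists_mellin_bound {E : Type*} [NormedAddCommGroup E] [NormedSpace ℝ E]
    (φ : 𝓢(E, ℂ)) {s : ℂ} (hs : 0 < s.re) {r : ℝ} (hr : 0 < r) :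
    ∃ b : ℝ → ℝ, IntegrableOn b (Ioi 0) ∧ ∀ u ∈ Ioi (0 : ℝ), ∀ x : E, r ≤ ‖x‖ →
      ‖(u : ℂ) ^ (s - 1) * φ (u • x)‖ ≤ b u := by
  obtain ⟨k, hk⟩ := exists_nat_gt s.re
  obtain ⟨C, hC⟩ := φ.exists_norm_le_inv_one_add_pow k
  have hC0 : 0 ≤ C := by
    have := (norm_nonneg _).trans (hC 0)
    simpa using this
  refine ⟨fun u => C * (u ^ (s.re - 1) * ((1 + r * u) ^ k)⁻¹),
    (integrableOn_rpow_mul_inv_one_add_pow hs hk hr).const_mul C, fun u hu x hx => ?_⟩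
  have hu : 0 < u := hu
  change _ ≤ C * (u ^ (s.re - 1) * ((1 + r * u) ^ k)⁻¹)
  rw [norm_mul, Complex.norm_cpow_eq_rpow_re_of_pos hu, mul_left_comm C, Complex.sub_re,
    Complex.one_re]
  refine mul_le_mul_of_nonneg_left ((hC _).trans ?_) (by positivity)
  rw [norm_smul, Real.norm_of_nonneg hu.le, mul_comm r]
  gcongr

theorem SchwartzMap.continuousOn_mellin_smul {E : Type*} [NormedAddCommGroup E] [NormedSpace ℝ E]
    (φ : 𝓢(E, ℂ)) {s : ℂ} (hs : 0 < s.re) :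
    ContinuousOn (fun x => mellin (fun u : ℝ => φ (u • x)) s) {0}ᶜ := by
  intro x hx
  have hx0 : 0 < ‖x‖ := norm_pos_iff.2 hx
  obtain ⟨b, hb, hle⟩ := φ.exists_mellin_bound hs (half_pos hx0)
  refine (continuousAt_of_dominated (bound := b) ?_ ?_ hb ?_).continuousWithinAt
  · filter_upwards [isOpen_compl_singleton.mem_nhds hx] with y hy
    exact (φ.mellinConvergent_smul hy hs).aestronglyMeasurable
  · filter_upwards [(isOpen_lt continuous_const continuous_norm).mem_nhds (half_lt_self hx0)]
      with y hy
    filter_upwards [ae_restrict_mem measurableSet_Ioi] with u hu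
    exact hle u hu y hy.le
  · exact Eventually.of_forall fun u => by fun_prop

variable {n : ℕ} {N : EuclideanSpace ℝ (Fin n) → ℝ} {η : ℝ → ℝ}

/-- Every power of `a > 0` is a superposition of the dilates of a profile. -/
theorem hasMellin_comp_mul_inv {f : ℝ → ℂ} (hf : Continuous f) (hc : HasCompactSupport f)
    (hs : tsupport f ⊆ Ioi 0) {a : ℝ} (ha : 0 < a) (p : ℂ) :
    HasMellin (fun u => f (a * u⁻¹)) p ((a : ℂ) ^ p * mellin f (-p)) := by
  constructor
  · have h1 : MellinConvergent (fun u => f (a * u)) (-p) :=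
      (MellinConvergent.comp_mul_left ha).2 (mellinConvergent_of_tsupport_subset hf hc hs _)
    have h2 := (MellinConvergent.comp_rpow (f := fun u => f (a * u)) (s := p) (a := -1)
      (by norm_num)).2 (by simpa [div_neg] using h1)
    simpa [Real.rpow_neg_one] using h2
  · have h1 := mellin_comp_inv (fun u => f (a * u)) p
    rw [h1, mellin_comp_mul_left _ _ ha, neg_neg, smul_eq_mul]

/-- The Fourier transform of a dilate, in the weak form. -/
theorem integral_comp_inv_smul_mul_schwartzFourier (h φ : 𝓢(EuclideanSpace ℝ (Fin n), ℂ)) {u : ℝ}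
    (hu : 0 < u) : ∫ x, h (u⁻¹ • x) * schwartzFourier n φ x =
      (u : ℂ) ^ n * ∫ ξ, schwartzFourier n h (u • ξ) * φ ξ := by
  have h1 := Measure.integral_comp_inv_smul_of_nonneg
    (volume : Measure (EuclideanSpace ℝ (Fin n)))
    (fun x => h x * schwartzFourier n φ (u • x)) hu.le
  simp only [smul_smul, mul_inv_cancel₀ hu.ne', one_smul, finrank_euclideanSpace,
    Fintype.card_fin, Complex.real_smul, Complex.ofReal_pow] at h1
  rw [h1]
  congr 1
  have hprod : Integrable (Function.uncurry fun x ξ : EuclideanSpace ℝ (Fin n) =>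
      h x * (Complex.exp (-Complex.I * (inner ℝ ξ (u • x) : ℝ)) * φ ξ)) (volume.prod volume) := by
    refine (h.integrable.mul_prod φ.integrable).mono ?_ (Eventually.of_forall fun p => ?_)
    · exact Continuous.aestronglyMeasurable (by fun_prop)
    · simp only [Function.uncurry, norm_mul, Complex.norm_exp]
      simp
  simp only [schwartzFourier_apply, ← integral_const_mul, ← integral_mul_const]
  rw [integral_integral_swap hprod]
  refine integral_congr_ae (Eventually.of_forall fun ξ => ?_)
  refine integral_congr_ae (Eventually.of_forall fun x => ?_)
  simp only [inner_smul_right, real_inner_comm ξ x]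
  ring

/-- Away from the origin, the Fourier transform of `N ^ p` is the superposition of the Fourier
transforms of the dilates of `h = η ∘ N`; here `p = -n + q + 1`. -/
theorem IsSmoothGauge.distributionFourier_eq (hn : 0 < n) (hN : IsSmoothGauge N)
    (hη : ContDiff ℝ ∞ η) (hηc : HasCompactSupport η) (hsupp : tsupport η ⊆ Ioi 0)
    {h : 𝓢(EuclideanSpace ℝ (Fin n), ℂ)} (hh : ∀ x, h x = (η (N x) : ℂ)) {q : ℂ}
    (hq : -1 < q.re) {T : 𝓢'(EuclideanSpace ℝ (Fin n), ℂ)}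
    (hT : IsDistributionOf T fun x => (N x : ℂ) ^ (-(n : ℂ) + q + 1))
    (φ : 𝓢(EuclideanSpace ℝ (Fin n), ℂ)) (hφ : tsupport φ ⊆ {0}ᶜ) :
    mellin (fun s => (η s : ℂ)) (n - 1 - q) * distributionFourier T φ =
      ∫ ξ, mellin (fun u : ℝ => schwartzFourier n h (u • ξ)) (q + 1) * φ ξ := by
  have : NeZero n := ⟨hn.ne'⟩
  set p : ℂ := -(n : ℂ) + q + 1 with hp
  have hpre : p.re = -(n : ℝ) + q.re + 1 := by simp [hp]
  have hηC : Continuous fun s => (η s : ℂ) := Complex.continuous_ofReal.comp hη.continuous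
  have hηc' : HasCompactSupport fun s => (η s : ℂ) := hηc.comp_left Complex.ofReal_zero
  have hts : tsupport (fun s => (η s : ℂ)) ⊆ Ioi 0 :=
    (closure_mono (t := Function.support η) fun s hs =>
      Complex.ofReal_ne_zero.1 (Function.mem_support.1 hs)).trans hsupp
  have hηA : Continuous fun s => ((|η s| : ℝ) : ℂ) :=
    Complex.continuous_ofReal.comp hη.continuous.abs
  have hηAc : HasCompactSupport fun s => ((|η s| : ℝ) : ℂ) :=
    hηc.comp_left (g := fun y : ℝ => ((|y| : ℝ) : ℂ)) (by simp)
  have hAts : tsupport (fun s => ((|η s| : ℝ) : ℂ)) ⊆ Ioi 0 :=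
    (closure_mono (t := Function.support η) fun s hs =>
      abs_ne_zero.1 (Complex.ofReal_ne_zero.1 (Function.mem_support.1 hs))).trans hsupp
  set ψ := schwartzFourier n φ
  have hae : ∀ᵐ x : EuclideanSpace ℝ (Fin n), x ≠ 0 :=
    compl_mem_ae_iff.2 (measure_singleton (0 : EuclideanSpace ℝ (Fin n)))
  -- the first interchange of integrals
  have hprod1 : Integrable (Function.uncurry fun (x : EuclideanSpace ℝ (Fin n)) (u : ℝ) =>
      (u : ℂ) ^ (p - 1) * (η (N x * u⁻¹) : ℂ) * ψ x)
      (volume.prod (volume.restrict (Ioi (0 : ℝ)))) := by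
    have hmeas : Measurable (Function.uncurry fun (x : EuclideanSpace ℝ (Fin n)) (u : ℝ) =>
        (u : ℂ) ^ (p - 1) * (η (N x * u⁻¹) : ℂ) * ψ x) := by
      have h1 : Measurable fun z : EuclideanSpace ℝ (Fin n) × ℝ => (η (N z.1 * z.2⁻¹) : ℂ) :=
        hηC.measurable.comp ((hN.continuous.measurable.comp measurable_fst).mul
          measurable_snd.inv)
      have h2 : Measurable fun z : EuclideanSpace ℝ (Fin n) × ℝ => ψ z.1 :=
        ψ.continuous.measurable.comp measurable_fst
      fun_prop
    rw [integrable_prod_iff hmeas.aestronglyMeasurable]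
    constructor
    · filter_upwards [hae] with x hx
      exact ((hasMellin_comp_mul_inv hηC hηc' hts (hN.pos x hx) p).1).mul_const (ψ x)
    · obtain ⟨T', hT'⟩ := hN.exists_isDistributionOf_cpow hn (p := (p.re : ℂ))
        (by rw [Complex.ofReal_re, hpre]; linarith)
      refine Integrable.mono ((hT' ψ).1.const_mul
        (mellin (fun s => ((|η s| : ℝ) : ℂ)) (-(p.re : ℂ)))) ?_ ?_
      · exact hmeas.norm.stronglyMeasurable.integral_prod_right.aestronglyMeasurable
      · filter_upwards [hae] with x hx
        have h1 := (hasMellin_comp_mul_inv hηA hηAc hAts (hN.pos x hx) (p.re : ℂ)).2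
        have h2 : ∫ u in Ioi (0 : ℝ), ‖(u : ℂ) ^ (p - 1) * (η (N x * u⁻¹) : ℂ) * ψ x‖ =
            (∫ u in Ioi (0 : ℝ), u ^ (p.re - 1) * |η (N x * u⁻¹)|) * ‖ψ x‖ := by
          rw [← integral_mul_const]
          refine setIntegral_congr_fun measurableSet_Ioi fun u hu => ?_
          simp only [norm_mul]
          rw [Complex.norm_cpow_eq_rpow_re_of_pos hu]
          simp
        have h3 : ((∫ u in Ioi (0 : ℝ), u ^ (p.re - 1) * |η (N x * u⁻¹)| : ℝ) : ℂ) =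
            mellin (fun u => ((|η (N x * u⁻¹)| : ℝ) : ℂ)) p.re := by
          rw [mellin, ← integral_complex_ofReal]
          refine setIntegral_congr_fun measurableSet_Ioi fun u hu => ?_
          have hu : 0 < u := hu
          simp only [smul_eq_mul]
          rw [Complex.ofReal_mul, Complex.ofReal_cpow hu.le]
          simp
        simp only [Function.uncurry]
        rw [h2, norm_mul, norm_norm, ← Complex.norm_real (∫ u in Ioi (0 : ℝ), _), h3, h1]
        simp only [norm_mul]
        apply le_of_eq
        ring
  have hstep1 : mellin (fun s => (η s : ℂ)) (n - 1 - q) * distributionFourier T φ =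
      ∫ u in Ioi (0 : ℝ), ∫ x, (u : ℂ) ^ (p - 1) * (η (N x * u⁻¹) : ℂ) * ψ x := by
    rw [distributionFourier_apply, (hT _).2, ← integral_integral_swap hprod1, ← integral_const_mul]
    refine integral_congr_ae ?_
    filter_upwards [hae] with x hx
    have h1 := (hasMellin_comp_mul_inv hηC hηc' hts (hN.pos x hx) p).2
    rw [integral_mul_const]
    change _ = mellin (fun u => (η (N x * u⁻¹) : ℂ)) p * ψ x
    rw [h1, show -p = n - 1 - q by rw [hp]; ring]
    ring
  have hstep2 : ∀ u ∈ Ioi (0 : ℝ), ∫ x, (u : ℂ) ^ (p - 1) * (η (N x * u⁻¹) : ℂ) * ψ x =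
      ∫ ξ, (u : ℂ) ^ (q + 1 - 1) * schwartzFourier n h (u • ξ) * φ ξ := by
    intro u hu
    have hu : 0 < u := hu
    have h1 := integral_comp_inv_smul_mul_schwartzFourier h φ hu
    have h2 : (u : ℂ) ^ (q + 1 - 1) = (u : ℂ) ^ (p - 1) * (u : ℂ) ^ n := by
      rw [← Complex.cpow_natCast, ← Complex.cpow_add _ _ (Complex.ofReal_ne_zero.2 hu.ne'), hp]
      congr 1
      ring
    simp only [mul_assoc]
    rw [integral_const_mul, integral_const_mul, h2, mul_assoc, ← h1]
    congr 1
    refine integral_congr_ae (Eventually.of_forall fun x => ?_)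
    simp only [hh, hN.smul _ (inv_nonneg.2 hu.le), mul_comm u⁻¹]
    rfl
  rw [hstep1, setIntegral_congr_fun measurableSet_Ioi hstep2]
  -- the second one uses that `φ` vanishes near the origin
  obtain ⟨r, hr, hφr⟩ : ∃ r > 0, ∀ ξ, ‖ξ‖ < r → φ ξ = 0 := by
    have h0 : (tsupport φ)ᶜ ∈ 𝓝 (0 : EuclideanSpace ℝ (Fin n)) :=
      (isClosed_tsupport _).isOpen_compl.mem_nhds fun h => hφ h rfl
    obtain ⟨r, hr, hsub⟩ := Metric.mem_nhds_iff.1 h0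
    exact ⟨r, hr, fun ξ hξ => image_eq_zero_of_notMem_tsupport (hsub (by simpa using hξ))⟩
  obtain ⟨b, hb, hle⟩ := (schwartzFourier n h).exists_mellin_bound (s := q + 1)
    (by simp only [Complex.add_re, Complex.one_re]; linarith) hr
  have hprod2 : Integrable (Function.uncurry fun (u : ℝ) (ξ : EuclideanSpace ℝ (Fin n)) =>
      (u : ℂ) ^ (q + 1 - 1) * schwartzFourier n h (u • ξ) * φ ξ)
      ((volume.restrict (Ioi (0 : ℝ))).prod volume) := by
    refine (hb.mul_prod φ.integrable.norm).mono ?_ ?_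
    · refine Measurable.aestronglyMeasurable ?_
      have h1 : Measurable fun z : ℝ × EuclideanSpace ℝ (Fin n) =>
        schwartzFourier n h (z.1 • z.2) := Continuous.measurable (by fun_prop)
      have h2 : Measurable fun z : ℝ × EuclideanSpace ℝ (Fin n) => φ z.2 :=
        Continuous.measurable (by fun_prop)
      fun_prop
    · have : ∀ᵐ z : ℝ × EuclideanSpace ℝ (Fin n)
          ∂((volume.restrict (Ioi (0 : ℝ))).prod volume), z.1 ∈ Ioi (0 : ℝ) :=
        Measure.quasiMeasurePreserving_fst.ae (ae_restrict_mem measurableSet_Ioi)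
      filter_upwards [this] with z hz
      simp only [Function.uncurry]
      rw [norm_mul, norm_mul (b z.1), norm_norm]
      rcases lt_or_ge ‖z.2‖ r with hzr | hzr
      · rw [hφr _ hzr]
        simp
      · exact mul_le_mul_of_nonneg_right ((hle _ hz _ hzr).trans (le_abs_self _)) (norm_nonneg _)
  rw [integral_integral_swap hprod2]
  exact integral_congr_ae (Eventually.of_forall fun ξ => integral_mul_const (φ ξ) _)

end OffZero

/-! ### The Fourier formula for the fractional derivatives -/

/-- No Mellin transform at a fixed point vanishes on all smooth profiles with compact support in
`(0, ∞)`. -/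
theorem exists_mellin_ne_zero (s : ℂ) :
    ∃ η : ℝ → ℝ, ContDiff ℝ ∞ η ∧ HasCompactSupport η ∧ tsupport η ⊆ Ioi 0 ∧
      mellin (fun t => (η t : ℂ)) s ≠ 0 := by
  by_contra! H
  have hc : ContinuousOn (fun t : ℝ => (t : ℂ) ^ (s - 1)) (Ioi 0) := fun t ht =>
    (Complex.continuousAt_ofReal_cpow_const t (s - 1)
      (Or.inr (ne_of_gt ht))).continuousWithinAt
  have hae := isOpen_Ioi.ae_eq_zero_of_integral_contDiff_smul_eq_zero
    (μ := (volume : Measure ℝ)) (hc.locallyIntegrableOn measurableSet_Ioi) fun g hg hgc hgs => by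
      rw [← H g hg hgc hgs, mellin, setIntegral_eq_integral_of_forall_compl_eq_zero]
      · refine integral_congr_ae (Eventually.of_forall fun t => ?_)
        simp [mul_comm]
      · intro t ht
        rw [image_eq_zero_of_notMem_tsupport fun h => ht (hgs h)]
        simp
  have h0 : volume (Ioi (0 : ℝ)) = 0 := by
    refine measure_mono_null (fun t ht => ?_) hae
    have ht0 : (t : ℂ) ≠ 0 := Complex.ofReal_ne_zero.2 (ne_of_gt ht)
    exact fun h => (Complex.cpow_ne_zero_iff.2 (Or.inl ht0)) (h ht)
  simp at h0

/-- In dimension zero this fails for `K = ∅`, whose gauge is that of `{0}`. -/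
theorem IsSymmetricStarBody.parallelSection_eq {n : ℕ} {K : Set (EuclideanSpace ℝ (Fin n))}
    (hK : IsSymmetricStarBody K) (hn : 0 < n) (ξ : EuclideanSpace ℝ (Fin n)) :
    parallelSection K ξ = sectionVolume (gauge K) ξ := by
  funext z
  simp only [parallelSection, sectionVolume, hK.gauge_le_one_iff hn]

theorem finrank_orthogonal_of_norm_eq_one {n : ℕ} {ξ : EuclideanSpace ℝ (Fin n)} (hξ : ‖ξ‖ = 1) :
    (Module.finrank ℝ (ℝ ∙ ξ)ᗮ : ℂ) = n - 1 := by
  have hξ0 : ξ ≠ 0 := by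
    rintro rfl
    simp at hξ
  have h1 := (ℝ ∙ ξ).finrank_add_finrank_orthogonal
  rw [finrank_span_singleton hξ0, finrank_euclideanSpace_fin] at h1
  have h2 := congrArg (Nat.cast : ℕ → ℂ) h1
  push_cast at h2
  linear_combination h2

theorem theorem2 (n : ℕ) (K : Set (EuclideanSpace ℝ (Fin n))) (hK : IsSymmetricStarBody K)
    (hsmooth : HasSmoothBoundary K) (q : ℂ) (hq : -1 < q.re) (hqn : q ≠ (n : ℂ) - 1) :
    ∃ (T : 𝓢'(EuclideanSpace ℝ (Fin n), ℂ)) (G : EuclideanSpace ℝ (Fin n) → ℂ),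
      IsDistributionOf T (fun x => (gauge K x : ℂ) ^ (-(n : ℂ) + q + 1)) ∧
      IsContinuousFunctionOffZero (distributionFourier T) G ∧
      ∀ ξ ∈ Metric.sphere (0 : EuclideanSpace ℝ (Fin n)) 1,
        IsFractionallyDifferentiable (parallelSection K ξ) q ∧
        fractionalDeriv (parallelSection K ξ) q =
          Complex.cos (q * Real.pi / 2) / (Real.pi * ((n : ℂ) - q - 1)) * G ξ := by
  rcases Nat.eq_zero_or_pos n with rfl | hn
  · -- the sphere is empty, and the function is `0 ^ (q + 1) = 0`
    have hq0 : q + 1 ≠ 0 := fun h => hqn (by rw [eq_neg_of_add_eq_zero_left h]; simp)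
    refine ⟨0, 0, fun φ => ?_, ⟨continuousOn_const, fun φ _ _ => ?_⟩, fun ξ hξ => ?_⟩
    · have h0 : ∀ x : EuclideanSpace ℝ (Fin 0),
          (gauge K x : ℂ) ^ (-((0 : ℕ) : ℂ) + q + 1) * φ x = 0 := fun x => by
        rw [Subsingleton.elim x 0, gauge_zero]
        simp [hq0]
      simp only [h0]
      simp
    · simp [distributionFourier_apply]
    · rw [Subsingleton.elim ξ 0] at hξ
      simp at hξ
  have hN := hK.isSmoothGauge hsmooth
  obtain ⟨η, hη, hηc, hsupp, hc⟩ := exists_mellin_ne_zero (n - 1 - q)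
  set c := mellin (fun s => (η s : ℂ)) (n - 1 - q)
  set h : 𝓢(EuclideanSpace ℝ (Fin n), ℂ) :=
    HasCompactSupport.toSchwartzMap (f := fun x => (η (gauge K x) : ℂ))
      ((hN.hasCompactSupport_comp hηc).comp_left (g := ((↑) : ℝ → ℂ)) Complex.ofReal_zero)
      (Complex.ofRealCLM.contDiff.comp (hN.contDiff_comp hη hsupp))
  have hh : ∀ x, h x = (η (gauge K x) : ℂ) := fun x => rfl
  obtain ⟨T, hT⟩ := hN.exists_isDistributionOf_cpow hn (p := -(n : ℂ) + q + 1) (by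
    simp only [Complex.add_re, Complex.neg_re, Complex.natCast_re, Complex.one_re]
    linarith)
  refine ⟨T, fun x => c⁻¹ * mellin (fun u : ℝ => schwartzFourier n h (u • x)) (q + 1), hT,
    ⟨?_, fun φ _ hφ => ?_⟩, fun ξ hξ => ?_⟩
  · refine ((schwartzFourier n h).continuousOn_mellin_smul (s := q + 1) ?_).const_mul c⁻¹
    simp only [Complex.add_re, Complex.one_re]
    linarith
  · have h1 := hN.distributionFourier_eq hn hη hηc hsupp hh hq hT φ hφ
    simp only [mul_assoc]
    rw [integral_const_mul, ← h1, inv_mul_cancel_left₀ hc]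
  · have hξ1 : ‖ξ‖ = 1 := by simpa using hξ
    rw [hK.parallelSection_eq hn]
    refine ⟨hN.isFractionallyDifferentiable_sectionVolume hξ1 q, ?_⟩
    have h1 := hN.fractionalDeriv_sectionVolume hξ1 hη hηc hsupp hh hq
    rw [finrank_orthogonal_of_norm_eq_one hξ1] at h1
    have hpi : (Real.pi : ℂ) ≠ 0 := Complex.ofReal_ne_zero.2 Real.pi_ne_zero
    have hnq : (n : ℂ) - 1 - q ≠ 0 := fun h => hqn (sub_eq_zero.1 h).symm
    rw [sub_right_comm (n : ℂ) q 1]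
    field_simp
    linear_combination h1
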